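/- A finite two-player game is given by a pair $(A,B)$ of $n\times m$ matrices of rational payoffs; it is constant-sum if there is a $c$ with $A_{ij}+B_{ij}=c$ for all $i,j$ (zero-sum if $c=0$). A subgame is a pair $(I,J)$ with $I\subseteq\{1,\dots,n\}$, $J\subseteq\{1,\dots,m\}$. Write $(I,J)\to_{<}(I\setminus\{i\},J)$ if there is $i_0\in I$ with $A_{i_0,j}\ge A_{i,j}$ for all $j\in J$ and $A_{i_0,j_0}>A_{i,j_0}$ for some $j_0\in J$; write $(I,J)\to_{<}(I,J\setminus\{j\})$ if there is $j_0\in J$ with $B_{i,j_0}\ge B_{i,j}$ for all $i\in I$ and $B_{i_0,j_0}>B_{i_0,j}$ for some $i_0\in I$. Let $\rightrightarrows_{<}$ be the reflexive and transitive closure of $\to_{<}$. The problem Z-Dominance has as input a constant-sum game $(A,B)$ and a row strategy $i\in\{1,\dots,n\}$, and asks whether there are $I,J$ with $(\{1,\dots,n\},\{1,\dots,m\})\rightrightarrows_{<}(I,J)$ and $i\notin I$. **Theorem.** Z-Dominance is in $P$: there are a deterministic Turing machine and a polynomial $p$ such that, for every instance, given as a word $w$ over a finite alphabet (the number of the strategy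 in unary, then both matrices row by row, each entry as a fraction in lowest terms with numerator and denominator in binary), the machine halts after at most $p(|w|)$ steps and outputs the correct answer. -/

import Mathlib

/-- A finite two-player game in normal form with `n` row strategies and `m` column strategies:
`A i j` is the payoff of the row player and `B i j` that of the column player. -/
structure BimatrixGame (n m : ℕ) where
  A : Matrix (Fin n) (Fin m) ℚ
  B : Matrix (Fin n) (Fin m) ℚ

namespace BimatrixGame

variable {n m : ℕ}

/-- A subgame, given by the sets of the remaining row and column strategies. -/
abbrev Subgame (n m : ℕ) : Type := Finset (Fin n) × Finset (Fin m)

/-- Elimination of a single (pure) strategy that is dominated by a remaining (pure) strategy. -/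
inductive DominanceStep (G : BimatrixGame n m) : Subgame n m → Subgame n m → Prop
  | row (I : Finset (Fin n)) (J : Finset (Fin m)) (i i₀ : Fin n) (hi₀ : i₀ ∈ I)
      (weak : ∀ j ∈ J, G.A i₀ j ≥ G.A i j) (strict : ∃ j₀ ∈ J, G.A i₀ j₀ > G.A i j₀) :
      DominanceStep G (I, J) (I.erase i, J)
  | col (I : Finset (Fin n)) (J : Finset (Fin m)) (j j₀ : Fin m) (hj₀ : j₀ ∈ J)
      (weak : ∀ i ∈ I, G.B i j₀ ≥ G.B i j) (strict : ∃ i₀ ∈ I, G.B i₀ j₀ > G.B i₀ j) :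
      DominanceStep G (I, J) (I, J.erase j)

/-- Iterated elimination of dominated strategies: the reflexive and transitive closure. -/
def DominanceReduces (G : BimatrixGame n m) : Subgame n m → Subgame n m → Prop :=
  Relation.ReflTransGen G.DominanceStep

/-- The row strategy `i` can be removed from the full game by iterated elimination of dominated
strategies. -/
def Eliminable (G : BimatrixGame n m) (i : Fin n) : Prop :=
  ∃ (I : Finset (Fin n)) (J : Finset (Fin m)),
    G.DominanceReduces (Finset.univ, Finset.univ) (I, J) ∧ i ∉ I

/-- Constant-sum games; zero-sum games are those with `c = 0`. -/
def IsConstantSum (G : BimatrixGame n m) : Prop :=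
  ∃ c : ℚ, ∀ i j, G.A i j + G.B i j = c

end BimatrixGame

/-- An instance of the problem Z-Dominance: a constant-sum game and one of its row strategies. -/
structure ZDominanceInstance where
  n : ℕ
  m : ℕ
  game : BimatrixGame n m
  constantSum : game.IsConstantSum
  strategy : Fin n

/-- The problem Z-Dominance: is the given row strategy eliminable in the given game? -/
def ZDominance (x : ZDominanceInstance) : Prop :=
  x.game.Eliminable x.strategy

/-- The input alphabet in which instances are written. -/
inductive GameSymbol
  | tally
  | bit (b : Bool)
  | slash
  | endEntry
  | endRow
  | endMatrix
  deriving DecidableEq, Fintype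

/-- A rational number as a sign bit, followed by the numerator and the denominator in binary. -/
def encodeRat (q : ℚ) : List GameSymbol :=
  GameSymbol.bit (decide (q < 0)) ::
    ((Computability.encodeNat q.num.natAbs).map GameSymbol.bit ++
      GameSymbol.slash :: (Computability.encodeNat q.den).map GameSymbol.bit)

/-- A row of payoffs, entry by entry. -/
def encodeRow {m : ℕ} (v : Fin m → ℚ) : List GameSymbol :=
  (List.finRange m).flatMap (fun j => encodeRat (v j) ++ [GameSymbol.endEntry]) ++
    [GameSymbol.endRow]

/-- A payoff matrix, row by row. -/
def encodeMatrix {n m : ℕ} (M : Matrix (Fin n) (Fin m) ℚ) : List GameSymbol :=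
  (List.finRange n).flatMap (fun i => encodeRow (M i)) ++ [GameSymbol.endMatrix]

/-- An instance is written as its strategy (numbered from `0`, in unary; this is never longer than
the matrices, which have more rows than that), followed by the two payoff matrices. -/
def encodeZDominanceInstance (x : ZDominanceInstance) : List GameSymbol :=
  List.replicate (x.strategy : ℕ) GameSymbol.tally ++
    (encodeMatrix x.game.A ++ encodeMatrix x.game.B)

/-- A decision problem on `α`, with instances written in a finite alphabet by `encode`, is in `P`:
some Turing machine halts on the encoding of each instance within polynomially many steps in the
length of the encoding, with the answer (one bit) as its output. -/
def DecidableInPolyTime {α Γ : Type} [Fintype Γ] (encode : α → List Γ) (problem : α → Prop) :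
    Prop :=
  ∃ answer : α → Bool, (∀ x, answer x = true ↔ problem x) ∧
    Nonempty (Turing.TM2ComputableInPolyTime encode Computability.encodeBool answer)

/-!
In a constant-sum game the payoffs of the second player may be replaced by the negatives of those of
the first, so that both players can be treated alike: the strategies of both form one set, and an
antisymmetric `U` gives the payoff of a strategy against a strategy of the opponent
(`SymmetricElimination.Game`). Proper elimination, with a strict inequality somewhere, depends on
the order of the eliminations. Weak elimination, which also removes one of two duplicates, does not
(`Game.Reachable.of_weakStep`): if two of its steps do not commute, then they remove two strategies
that are duplicates of each other, and exchanging the two is harmless. Weak elimination in turn can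
be imitated by proper elimination, except that duplicates of remaining strategies stay
(`Game.exists_strict_of_weak`), and by antisymmetry a duplicate makes no difference to the
comparison of the opponent's strategies.

Hence `k` is eliminable if and only if there are `r` and `c` such that `r` does strictly better than
`k` against `c`, and weak elimination that spares `r`, `k` and `c` leads to a subgame in which `r`
is at least as good as `k` (`Game.exists_strict_iff`). For given `r` and `c`, by order independence,
this can be decided by greedy elimination until nothing more can be removed
(`Game.reachable_iff_of_terminal`), which takes at most as many sweeps over the strategies as there
are strategies. Entries are compared by cross-multiplication.

To see that this algorithm runs in polynomial time on a Turing machine with several stacks, it is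
written as a composition of functions on data that are represented by binary trees on one of the
stacks. `PolyTime f` says that a program in a structured language of stack operations computes `f`
in polynomial time. This property is closed under composition, pairing, case distinction and, if the
intermediate values remain of polynomial size, under folding over a list (`PolyTime.foldl`), and so
the algorithm has it (`PolyTime.decideEliminable`). The programs are compiled to Turing machines
that make the same number of steps (`Exec.steps`), and together with the loading of the input this
yields `decidableInPolyTime_of_polyTime`.
-/

/-! ### A structured language on stacks and its compilation to Turing machines -/

namespace StackProg

/-- The working stacks: `out` receives the answer, `main` holds the data, and the others are scratch
space, empty between any two high-level operations. -/
inductive Work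
  | out | main | a | b | c | d
  deriving DecidableEq

instance : Fintype Work :=
  ⟨{.out, .main, .a, .b, .c, .d}, fun k => by cases k <;> decide⟩

variable {Γ : Type}

/-- All stacks: the input stack `none`, and the working stacks. -/
abbrev Stack : Type := Option Work

/-- The stack alphabets: the working stacks hold bits. -/
abbrev Alphabet (Γ : Type) : Stack → Type
  | none => Γ
  | some _ => Bool

/-- The register of the machine: the result of the last `pop`, which is `none` if the stack was
empty. -/
abbrev Register (Γ : Type) : Type := Option (Bool ⊕ Γ)

/-- The value that a `pop` leaves in the register. -/
def readHead : (k : Stack) → Option (Alphabet Γ k) → Register Γ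
  | none, s => s.map Sum.inr
  | some _, s => s.map Sum.inl

/-- Structured programs on the stacks. -/
inductive Prog (Γ : Type)
  | push (k : Work) (f : Register Γ → Bool)
  | pop (k : Stack)
  | seq (p q : Prog Γ)
  | ifte (c : Register Γ → Bool) (p q : Prog Γ)
  | loop (c : Register Γ → Bool) (p : Prog Γ)

/-- A state of a program: the register, the input stack, and the working stacks. -/
structure State (Γ : Type) where
  reg : Register Γ
  inp : List Γ
  wk : Work → List Bool

/-- `Exec p a b n`: started in state `a`, the program `p` stops in state `b` after `n` steps. -/
inductive Exec : Prog Γ → State Γ → State Γ → ℕ → Prop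
  | push (k f v i s) : Exec (.push k f) ⟨v, i, s⟩ ⟨v, i, Function.update s k (f v :: s k)⟩ 1
  | popInput (v i s) : Exec (.pop none) ⟨v, i, s⟩ ⟨i.head?.map Sum.inr, i.tail, s⟩ 1
  | popWork (k v i s) : Exec (.pop (some k)) ⟨v, i, s⟩
      ⟨(s k).head?.map Sum.inl, i, Function.update s k (s k).tail⟩ 1
  | seq {p q a b c m n} : Exec p a b m → Exec q b c n → Exec (.seq p q) a c (m + n)
  | ifTrue {c p q a b n} : c a.reg = true → Exec p a b n → Exec (.ifte c p q) a b (n + 1)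
  | ifFalse {c p q a b n} : c a.reg = false → Exec q a b n → Exec (.ifte c p q) a b (n + 1)
  | loopTrue {c p a b d m n} : c a.reg = true → Exec p a b m → Exec (.loop c p) b d n →
      Exec (.loop c p) a d (m + n + 1)
  | loopFalse {c p a} : c a.reg = false → Exec (.loop c p) a a 1

/-- The labels of a program: the positions at which a step of the machine begins. -/
def Label : Prog Γ → Type
  | .push _ _ => Unit
  | .pop _ => Unit
  | .seq p q => Label p ⊕ Label q
  | .ifte _ p q => Option (Label p ⊕ Label q)
  | .loop _ p => Option (Label p)

instance Label.fintype : (p : Prog Γ) → Fintype (Label p)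
  | .push _ _ => inferInstanceAs (Fintype Unit)
  | .pop _ => inferInstanceAs (Fintype Unit)
  | .seq p q =>
    letI := Label.fintype p
    letI := Label.fintype q
    inferInstanceAs (Fintype (Label p ⊕ Label q))
  | .ifte _ p q =>
    letI := Label.fintype p
    letI := Label.fintype q
    inferInstanceAs (Fintype (Option (Label p ⊕ Label q)))
  | .loop _ p =>
    letI := Label.fintype p
    inferInstanceAs (Fintype (Option (Label p)))

/-- The label at which a program starts. -/
def entry : (p : Prog Γ) → Label p
  | .push _ _ => ()
  | .pop _ => ()
  | .seq p _ => Sum.inl (entry p)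
  | .ifte _ _ _ => none
  | .loop _ _ => none

open Turing in
/-- The machine code of a program that is a part of a machine with labels `L`: `inj` places its
labels among those of the machine, and `exit` is the label to jump to at the end. -/
def code {L : Type} : (p : Prog Γ) → (Label p → L) → L → Label p →
    TM2.Stmt (Alphabet Γ) L (Register Γ)
  | .push k f, _, exit, _ => .push (some k) f (.goto fun _ => exit)
  | .pop k, _, exit, _ => .pop k (fun _ h => readHead k h) (.goto fun _ => exit)
  | .seq p q, inj, _, Sum.inl l =>
    code p (fun l => inj (Sum.inl l)) (inj (Sum.inr (entry q))) l
  | .seq _ q, inj, exit, Sum.inr l => code q (fun l => inj (Sum.inr l)) exit l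
  | .ifte c p q, inj, _, none =>
    .branch c (.goto fun _ => inj (some (Sum.inl (entry p))))
      (.goto fun _ => inj (some (Sum.inr (entry q))))
  | .ifte _ p _, inj, exit, some (Sum.inl l) => code p (fun l => inj (some (Sum.inl l))) exit l
  | .ifte _ _ q, inj, exit, some (Sum.inr l) => code q (fun l => inj (some (Sum.inr l))) exit l
  | .loop c p, inj, exit, none =>
    .branch c (.goto fun _ => inj (some (entry p))) (.goto fun _ => exit)
  | .loop _ p, inj, _, some l => code p (fun l => inj (some l)) (inj none) l

theorem code_ifte_entry {L : Type} (c : Register Γ → Bool) (p q : Prog Γ)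
    (inj : Label (.ifte c p q) → L) (exit : L) :
    code (.ifte c p q) inj exit (entry (.ifte c p q)) =
      .branch c (.goto fun _ => inj (some (Sum.inl (entry p))))
        (.goto fun _ => inj (some (Sum.inr (entry q)))) := rfl

theorem code_loop_entry {L : Type} (c : Register Γ → Bool) (p : Prog Γ)
    (inj : Label (.loop c p) → L) (exit : L) :
    code (.loop c p) inj exit (entry (.loop c p)) =
      .branch c (.goto fun _ => inj (some (entry p))) (.goto fun _ => exit) := rfl

/-- The stacks of a state, as those of a machine. -/
def State.stk (s : State Γ) : (k : Stack) → List (Alphabet Γ k)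
  | none => s.inp
  | some k => s.wk k

/-- The configuration of a machine at label `l` that corresponds to a state. -/
def State.cfg {L : Type} (l : Option L) (s : State Γ) :
    Turing.TM2.Cfg (Alphabet Γ) L (Register Γ) :=
  ⟨l, s.reg, s.stk⟩

theorem update_stk_work (v v' : Register Γ) (i : List Γ) (s : Work → List Bool) (k : Work)
    (l : List Bool) :
    Function.update (State.stk ⟨v, i, s⟩) (some k) l
      = State.stk ⟨v', i, Function.update s k l⟩ := by
  funext j
  rcases j with _ | j
  · simp [State.stk]
  · by_cases h : j = k
    · subst h; simp [State.stk]
    · simp [State.stk, h]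

theorem update_stk_input (v v' : Register Γ) (i l : List Γ) (s : Work → List Bool) :
    Function.update (State.stk ⟨v, i, s⟩) none l = State.stk ⟨v', l, s⟩ := by
  funext j
  rcases j with _ | j <;> simp [State.stk]

/-- `Steps f c n c'`: iterating the partial function `f` leads from `c` to `c'` in `n` steps. -/
def Steps {C : Type} (f : C → Option C) (c : C) (n : ℕ) (c' : C) : Prop :=
  (flip bind f)^[n] (some c) = some c'

theorem Steps.trans {C : Type} {f : C → Option C} {a b c : C} {m n : ℕ} (h : Steps f a m b)
    (h' : Steps f b n c) : Steps f a (m + n) c := by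
  unfold Steps at *
  rw [Nat.add_comm, Function.iterate_add_apply, h, h']

theorem Steps.head {C : Type} {f : C → Option C} {a b c : C} {n : ℕ} (h : f a = some b)
    (h' : Steps f b n c) : Steps f a (n + 1) c := by
  unfold Steps at *
  rw [Function.iterate_succ_apply]
  simpa [flip, h] using h'

/-- The machine code of a program does what the program does, in the same number of steps. -/
theorem Exec.steps {L : Type} {M : L → Turing.TM2.Stmt (Alphabet Γ) L (Register Γ)} {p : Prog Γ}
    {a b : State Γ} {n : ℕ} (h : Exec p a b n) :
    ∀ (inj : Label p → L) (exit : L), (∀ l, M (inj l) = code p inj exit l) →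
      Steps (Turing.TM2.step M) (a.cfg (some (inj (entry p)))) n (b.cfg (some exit)) := by
  induction h with
  | push k f v i s =>
    intro inj exit hM
    refine Steps.head (b := State.cfg (some exit) _) ?_ rfl
    simp only [State.cfg, Turing.TM2.step, hM, code, Turing.TM2.stepAux]
    rw [update_stk_work v v]
    rfl
  | popInput v i s =>
    intro inj exit hM
    refine Steps.head (b := State.cfg (some exit) _) ?_ rfl
    simp only [State.cfg, Turing.TM2.step, hM, code, Turing.TM2.stepAux]
    rw [update_stk_input v (i.head?.map Sum.inr)]
    rfl
  | popWork k v i s =>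
    intro inj exit hM
    refine Steps.head (b := State.cfg (some exit) _) ?_ rfl
    simp only [State.cfg, Turing.TM2.step, hM, code, Turing.TM2.stepAux]
    rw [update_stk_work v ((s k).head?.map Sum.inl)]
    rfl
  | seq _ _ ih₁ ih₂ =>
    intro inj exit hM
    exact (ih₁ (fun l => inj (Sum.inl l)) _ fun l => hM (Sum.inl l)).trans
      (ih₂ (fun l => inj (Sum.inr l)) exit fun l => hM (Sum.inr l))
  | ifTrue hc _ ih =>
    intro inj exit hM
    refine Steps.head ?_ (ih (fun l => inj (some (Sum.inl l))) exit fun l => hM (some (Sum.inl l)))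
    simp only [State.cfg, Turing.TM2.step, hM, code_ifte_entry, Turing.TM2.stepAux, hc, cond_true]
  | ifFalse hc _ ih =>
    intro inj exit hM
    refine Steps.head ?_ (ih (fun l => inj (some (Sum.inr l))) exit fun l => hM (some (Sum.inr l)))
    simp only [State.cfg, Turing.TM2.step, hM, code_ifte_entry, Turing.TM2.stepAux, hc, cond_false]
  | loopTrue hc _ _ ih₁ ih₂ =>
    intro inj exit hM
    refine Steps.head ?_ ((ih₁ (fun l => inj (some l)) (inj (entry (.loop _ _)))
      fun l => hM (some l)).trans (ih₂ inj exit hM))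
    simp only [State.cfg, Turing.TM2.step, hM, code_loop_entry, Turing.TM2.stepAux, hc, cond_true]
  | loopFalse hc =>
    intro inj exit hM
    refine Steps.head (b := State.cfg (some exit) _) ?_ rfl
    simp only [State.cfg, Turing.TM2.step, hM, code_loop_entry, Turing.TM2.stepAux, hc, cond_false]

/-- The Turing machine that runs a program and then halts. -/
def machine [Fintype Γ] (p : Prog Γ) : Turing.FinTM2 where
  K := Stack
  k₀ := none
  k₁ := some .out
  Γ := Alphabet Γ
  Λ := Option (Label p)
  main := some (entry p)
  σ := Register Γ
  initialState := none
  Γk₀Fin := inferInstanceAs (Fintype Γ)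
  m
    | none => .halt
    | some l => code p some none l

theorem initList_machine [Fintype Γ] (p : Prog Γ) (l : List Γ) :
    Turing.initList (machine p) l = State.cfg (some (some (entry p))) ⟨none, l, fun _ => []⟩ := by
  unfold Turing.initList State.cfg
  congr 1
  funext k
  rcases k with _ | k <;> rfl

theorem haltList_machine [Fintype Γ] (p : Prog Γ) (l : List Bool) :
    Turing.haltList (machine p) l =
      State.cfg none ⟨none, [], Function.update (fun _ => []) .out l⟩ := by
  unfold Turing.haltList State.cfg
  congr 1
  funext k
  rcases k with _ | k
  · rfl
  · cases k <;> rfl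

/-- A program that answers the instances of a problem in polynomial time yields a machine. -/
theorem decidableInPolyTime_of_exec {α : Type} [Fintype Γ] (enc : α → List Γ) (problem : α → Prop)
    (answer : α → Bool) (hanswer : ∀ a, answer a = true ↔ problem a) (p : Prog Γ)
    (q : Polynomial ℕ)
    (hp : ∀ a, ∃ n ≤ q.eval (enc a).length, Exec p ⟨none, enc a, fun _ => []⟩
      ⟨none, [], Function.update (fun _ => []) .out [answer a]⟩ n) :
    DecidableInPolyTime enc problem := by
  choose n hn h using hp
  refine ⟨answer, hanswer, ⟨⟨⟨machine p, Equiv.refl _, Equiv.refl _⟩, q + 1, fun a =>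
    ⟨⟨n a + 1, ?_⟩, ?_⟩⟩⟩⟩
  · have h₁ := (h a).steps (M := (machine p).m) some none (fun l => rfl)
    have h₂ : Steps (machine p).step (Turing.initList (machine p) (enc a)) (n a + 1)
        (Turing.haltList (machine p) [answer a]) :=
      (congrArg (fun c => (flip bind (machine p).step)^[n a + 1] (some c))
        (initList_machine p (enc a))).trans
        (Eq.trans (h₁.trans (Steps.head (n := 0) (c := State.cfg none _) rfl rfl))
          (congrArg some (haltList_machine p [answer a]).symm))
    have h₃ : List.map (Equiv.refl Γ).invFun (enc a) = enc a := List.map_id _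
    refine Eq.trans ?_ h₂
    exact congrArg (fun l => (flip bind (machine p).step)^[n a + 1]
      (some (Turing.initList (machine p) l))) h₃
  · have := hn a
    simp only [Polynomial.eval_add, Polynomial.eval_one]
    omega

end StackProg

/-! ### Binary trees on the main stack -/

namespace StackProg

variable {Γ : Type}

/-- `Runs p s s' t`: the program `p` leads from `s` to `s'` in at most `t` steps. -/
def Runs (p : Prog Γ) (s s' : State Γ) (t : ℕ) : Prop :=
  ∃ n ≤ t, Exec p s s' n

theorem Runs.mono {p : Prog Γ} {s s' : State Γ} {t t' : ℕ} (h : Runs p s s' t) (ht : t ≤ t') :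
    Runs p s s' t' :=
  h.imp fun _ hn => ⟨hn.1.trans ht, hn.2⟩

theorem Runs.of_eq {p : Prog Γ} {v v' : Register Γ} {i : List Γ} {s s' : Work → List Bool}
    {e : State Γ} {t : ℕ} (h : Runs p ⟨v', i, s'⟩ e t) (hv : v = v') (hs : s = s') :
    Runs p ⟨v, i, s⟩ e t := by
  rwa [hv, hs]

theorem Runs.push (k f v i) (s : Work → List Bool) :
    Runs (Γ := Γ) (.push k f) ⟨v, i, s⟩ ⟨v, i, Function.update s k (f v :: s k)⟩ 1 :=
  ⟨1, le_rfl, .push ..⟩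

theorem Runs.pop (k v i) (s : Work → List Bool) :
    Runs (Γ := Γ) (.pop (some k)) ⟨v, i, s⟩
      ⟨(s k).head?.map Sum.inl, i, Function.update s k (s k).tail⟩ 1 :=
  ⟨1, le_rfl, .popWork ..⟩

theorem Runs.seq {p q : Prog Γ} {a b c : State Γ} {m n : ℕ} (h : Runs p a b m)
    (h' : Runs q b c n) : Runs (.seq p q) a c (m + n) := by
  obtain ⟨k, hk, h⟩ := h
  obtain ⟨l, hl, h'⟩ := h'
  exact ⟨k + l, by omega, .seq h h'⟩

theorem Runs.ifTrue {c} {p q : Prog Γ} {a b : State Γ} {n : ℕ} (hc : c a.reg = true)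
    (h : Runs p a b n) : Runs (.ifte c p q) a b (n + 1) := by
  obtain ⟨k, hk, h⟩ := h
  exact ⟨k + 1, by omega, .ifTrue hc h⟩

theorem Runs.ifFalse {c} {p q : Prog Γ} {a b : State Γ} {n : ℕ} (hc : c a.reg = false)
    (h : Runs q a b n) : Runs (.ifte c p q) a b (n + 1) := by
  obtain ⟨k, hk, h⟩ := h
  exact ⟨k + 1, by omega, .ifFalse hc h⟩

theorem Runs.loopTrue {c} {p : Prog Γ} {a b d : State Γ} {m n : ℕ} (hc : c a.reg = true)
    (h : Runs p a b m) (h' : Runs (.loop c p) b d n) : Runs (.loop c p) a d (m + n + 1) := by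
  obtain ⟨k, hk, h⟩ := h
  obtain ⟨l, hl, h'⟩ := h'
  exact ⟨k + l + 1, by omega, .loopTrue hc h h'⟩

theorem Runs.loopFalse {c} {p : Prog Γ} {a : State Γ} (hc : c a.reg = false) :
    Runs (.loop c p) a a 1 :=
  ⟨1, le_rfl, .loopFalse hc⟩

/-- The test whether the register holds the bit `1`. -/
def isTrue : Register Γ → Bool
  | some (Sum.inl b) => b
  | _ => false

/-- Pushes the bit `b`. -/
abbrev pushBit (k : Work) (b : Bool) : Prog Γ := .push k fun _ => b

/-- Pushes the bit that is in the register. -/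
abbrev pushReg (k : Work) : Prog Γ := .push k isTrue

/-- Pours the stack `k` onto the stack `l`, which reverses it. -/
def pour (k l : Work) : Prog Γ :=
  .seq (.pop (some k)) (.loop Option.isSome (.seq (pushReg l) (.pop (some k))))

theorem runs_pour {k l : Work} (hkl : k ≠ l) (v : Register Γ) (i : List Γ) (s : Work → List Bool) :
    Runs (pour k l) ⟨v, i, s⟩
      ⟨none, i, Function.update (Function.update s l ((s k).reverse ++ s l)) k []⟩
      (3 * (s k).length + 2) := by
  suffices H : ∀ (x : List Bool) (s : Work → List Bool), s k = x →
      Runs (.loop Option.isSome (.seq (pushReg l) (.pop (some k))))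
        ⟨x.head?.map Sum.inl, i, Function.update s k x.tail⟩
        ⟨none, i, Function.update (Function.update s l (x.reverse ++ s l)) k []⟩
        (3 * x.length + 1) from
    ((Runs.pop k v i s).seq (H _ s rfl)).mono (by omega)
  intro x
  induction x with
  | nil =>
    intro s hs
    simp only [List.head?_nil, Option.map_none, List.tail_nil, List.reverse_nil, List.nil_append,
      Function.update_eq_self]
    exact Runs.loopFalse rfl
  | cons b x ih =>
    intro s hs
    have h := ih (Function.update (Function.update s k x) l (b :: s l)) (by simp [hkl])
    have e : Function.update (Function.update (Function.update (Function.update s k x) l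
        (b :: s l)) l (x.reverse ++ Function.update (Function.update s k x) l (b :: s l) l)) k [] =
        Function.update (Function.update s l ((b :: x).reverse ++ s l)) k [] := by
      funext j
      by_cases h₁ : j = k <;> by_cases h₂ : j = l <;> simp_all
    rw [e] at h
    refine ((Runs.loopTrue rfl ((Runs.push ..).seq (Runs.pop ..)) ?_ (n := 3 * x.length + 1)).mono
      (by simp only [List.length_cons]; omega))
    refine h.of_eq ?_ ?_
    · simp [hkl]
    · funext j
      by_cases h₁ : j = k <;> by_cases h₂ : j = l <;> simp_all [isTrue]

/-- Empties the stack `k`. -/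
def clear (k : Work) : Prog Γ :=
  .seq (.pop (some k)) (.loop Option.isSome (.pop (some k)))

theorem runs_clear (k : Work) (v : Register Γ) (i : List Γ) (s : Work → List Bool) :
    Runs (clear k) ⟨v, i, s⟩ ⟨none, i, Function.update s k []⟩ (2 * (s k).length + 2) := by
  suffices H : ∀ (x : List Bool) (s : Work → List Bool), s k = x →
      Runs (.loop Option.isSome (.pop (some k)))
        ⟨x.head?.map Sum.inl, i, Function.update s k x.tail⟩
        ⟨none, i, Function.update s k []⟩ (2 * x.length + 1) from
    ((Runs.pop k v i s).seq (H _ s rfl)).mono (by omega)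
  intro x
  induction x with
  | nil => exact fun s hs => Runs.loopFalse rfl
  | cons b x ih =>
    intro s hs
    have h := ih (Function.update s k x) (by simp)
    refine ((Runs.loopTrue rfl (Runs.pop ..) ?_ (n := 2 * x.length + 1)).mono
      (by simp only [List.length_cons]; omega))
    convert h using 2 <;> simp

/-- Binary trees, the universal data type. -/
inductive BinTree
  | leaf
  | node (a b : BinTree)

/-- A tree in preorder, `1` for an inner node and `0` for a leaf. This is self-delimiting, so that
trees can be put on top of each other on a stack. -/
def BinTree.code : BinTree → List Bool
  | .leaf => [false]
  | .node a b => true :: (a.code ++ b.code)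

/-- The number of nodes of a tree. -/
def BinTree.size : BinTree → ℕ
  | .leaf => 1
  | .node a b => a.size + b.size + 1

@[simp]
theorem BinTree.length_code (t : BinTree) : t.code.length = t.size := by
  induction t <;> simp_all [code, size]

/-- Moves one node from the main stack to the stack `k`. -/
def moveNode (k : Work) : Prog Γ :=
  .seq (.pop (some .main)) (.seq (.ifte isTrue
    (.seq (pushBit k true) (.seq (pushBit .d true) (pushBit .d true))) (pushBit k false))
    (.pop (some .d)))

/-- Moves the tree on top of the main stack to the stack `k`. The stack `d` counts the trees that
are yet to come. -/
def moveTree (k : Work) : Prog Γ :=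
  .seq (pushBit .d true) (.seq (.pop (some .d)) (.loop Option.isSome (moveNode k)))

theorem runs_moveTree_loop {k : Work} (hk : k ≠ .main) (hk' : k ≠ .d) (i : List Γ) {e : State Γ}
    (t : BinTree) : ∀ (v : Register Γ) (s : Work → List Bool) (rest : List Bool) (n : ℕ),
      v.isSome = true → s .main = t.code ++ rest →
      Runs (.loop Option.isSome (moveNode k)) ⟨(s .d).head?.map Sum.inl, i,
        Function.update (Function.update (Function.update s .main rest) k
          (t.code.reverse ++ s k)) .d (s .d).tail⟩ e n →
      Runs (.loop Option.isSome (moveNode k)) ⟨v, i, s⟩ e (n + 7 * t.size) := by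
  induction t with
  | leaf =>
    intro v s rest n hv hs h
    refine (Runs.loopTrue hv ((Runs.pop ..).seq ((Runs.ifFalse ?_ (Runs.push ..)).seq
      (Runs.pop ..))) ?_ (n := n)).mono (by simp only [BinTree.size]; omega)
    · simp [hs, BinTree.code, isTrue]
    · refine h.of_eq ?_ ?_
      · simp [hk'.symm]
      · funext j
        by_cases h₁ : j = .main <;> by_cases h₂ : j = k <;> by_cases h₃ : j = .d <;>
          simp_all [BinTree.code]
  | node t₁ t₂ ih₁ ih₂ =>
    intro v s rest n hv hs h
    let s₁ : Work → List Bool := Function.update (Function.update (Function.update s .main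
      (t₁.code ++ (t₂.code ++ rest))) k (true :: s k)) .d (true :: s .d)
    have h₁ := ih₁ (some (Sum.inl true)) s₁ (t₂.code ++ rest) (n + 7 * t₂.size) rfl
      (by simp [s₁, hk.symm]) (ih₂ _ _ rest n (by simp [s₁]) (by simp [hk.symm]) (by
        refine h.of_eq ?_ ?_
        · simp [s₁]
        · funext j
          by_cases h₁ : j = .main <;> by_cases h₂ : j = k <;> by_cases h₃ : j = .d <;>
            simp_all [BinTree.code, s₁]))
    refine (Runs.loopTrue hv ((Runs.pop ..).seq ((Runs.ifTrue ?_ ((Runs.push ..).seq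
      ((Runs.push ..).seq (Runs.push ..)))).seq (Runs.pop ..))) ?_
      (n := n + 7 * t₂.size + 7 * t₁.size)).mono (by simp only [BinTree.size]; omega)
    · simp [hs, BinTree.code, isTrue]
    · refine h₁.of_eq ?_ ?_
      · simp
      · funext j
        by_cases h₁ : j = .main <;> by_cases h₂ : j = k <;> by_cases h₃ : j = .d <;>
          simp_all [BinTree.code, s₁]

theorem runs_moveTree {k : Work} (hk : k ≠ .main) (hk' : k ≠ .d) (v : Register Γ) (i : List Γ)
    (t : BinTree) (s : Work → List Bool) (rest : List Bool) (hd : s .d = [])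
    (hs : s .main = t.code ++ rest) :
    Runs (moveTree k) ⟨v, i, s⟩ ⟨none, i, Function.update (Function.update s .main rest) k
        (t.code.reverse ++ s k)⟩ (7 * t.size + 3) := by
  refine ((Runs.push ..).seq ((Runs.pop ..).seq (runs_moveTree_loop hk hk' i t _ _ rest 1 ?_ ?_
    ?_))).mono (by omega)
  · simp
  · simp [hs]
  · refine (Runs.loopFalse (c := Option.isSome) rfl).of_eq ?_ ?_
    · simp [hd]
    · funext j
      by_cases h₁ : j = .main <;> by_cases h₂ : j = k <;> by_cases h₃ : j = .d <;>
        simp_all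

/-- The working stacks when only the main stack and the scratch stacks `a`, `b`, `c` are in use. -/
def stk (m : List Bool) (a b c : List Bool := []) : Work → List Bool
  | .main => m
  | .a => a
  | .b => b
  | .c => c
  | _ => []

/-- `Main p m m' t`: the program `p`, started with empty scratch stacks, turns the contents `m` of
the main stack into `m'` in at most `t` steps. -/
def Main (p : Prog Γ) (m m' : List Bool) (t : ℕ) : Prop :=
  ∀ v i, ∃ v', Runs p ⟨v, i, stk m⟩ ⟨v', i, stk m'⟩ t

theorem Main.mono {p : Prog Γ} {m m' : List Bool} {t t' : ℕ} (h : Main p m m' t) (ht : t ≤ t') :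
    Main p m m' t' :=
  fun v i => (h v i).imp fun _ h => h.mono ht

theorem Main.seq {p q : Prog Γ} {a b c : List Bool} {m n : ℕ} (h : Main p a b m)
    (h' : Main q b c n) : Main (.seq p q) a c (m + n) := fun v i => by
  obtain ⟨v', h⟩ := h v i
  obtain ⟨v'', h'⟩ := h' v' i
  exact ⟨v'', h.seq h'⟩

theorem main_pushBit (b : Bool) (m : List Bool) :
    Main (Γ := Γ) (pushBit .main b) m (b :: m) 1 := fun v i => ⟨v, by
  convert Runs.push Work.main (fun _ => b) v i (stk m) using 2
  funext j
  cases j <;> rfl⟩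

/-- Pops a bit and branches on it. -/
def popIte (p q : Prog Γ) : Prog Γ := .seq (.pop (some .main)) (.ifte isTrue p q)

theorem update_stk_main (m m' a b c : List Bool) :
    Function.update (stk m a b c) .main m' = stk m' a b c := by
  funext j
  cases j <;> rfl

theorem update_stk_a (m a' a b c : List Bool) :
    Function.update (stk m a b c) .a a' = stk m a' b c := by
  funext j
  cases j <;> rfl

theorem update_stk_b (m b' a b c : List Bool) :
    Function.update (stk m a b c) .b b' = stk m a b' c := by
  funext j
  cases j <;> rfl

theorem update_stk_c (m c' a b c : List Bool) :
    Function.update (stk m a b c) .c c' = stk m a b c' := by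
  funext j
  cases j <;> rfl

theorem runs_pop_main (v : Register Γ) (i : List Γ) (b : Bool) (m : List Bool) :
    Runs (.pop (some .main)) ⟨v, i, stk (b :: m)⟩ ⟨some (Sum.inl b), i, stk m⟩ 1 := by
  have h := Runs.pop Work.main v i (stk (b :: m))
  rwa [update_stk_main] at h

theorem Main.popIte_true {p q : Prog Γ} {m m' : List Bool} {t : ℕ} (h : Main p m m' t) :
    Main (popIte p q) (true :: m) m' (t + 2) := fun v i => by
  obtain ⟨v', h⟩ := h (some (Sum.inl true)) i
  exact ⟨v', ((runs_pop_main v i true m).seq (h.ifTrue rfl)).mono (by omega)⟩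

theorem Main.popIte_false {p q : Prog Γ} {m m' : List Bool} {t : ℕ} (h : Main q m m' t) :
    Main (popIte p q) (false :: m) m' (t + 2) := fun v i => by
  obtain ⟨v', h⟩ := h (some (Sum.inl false)) i
  exact ⟨v', ((runs_pop_main v i false m).seq (h.ifFalse rfl)).mono (by omega)⟩

theorem main_pop (b : Bool) (m : List Bool) :
    Main (Γ := Γ) (.pop (some .main)) (b :: m) m 1 := fun v i => ⟨_, runs_pop_main v i b m⟩

theorem runs_moveTree_a (v : Register Γ) (i : List Γ) (t : BinTree) (m a b c : List Bool) :
    Runs (moveTree .a) ⟨v, i, stk (t.code ++ m) a b c⟩ ⟨none, i, stk m (t.code.reverse ++ a) b c⟩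
      (7 * t.size + 3) := by
  have h := runs_moveTree (k := .a) (by decide) (by decide) v i t (stk (t.code ++ m) a b c) m
    rfl rfl
  rwa [update_stk_main, update_stk_a] at h

theorem runs_moveTree_b (v : Register Γ) (i : List Γ) (t : BinTree) (m a b c : List Bool) :
    Runs (moveTree .b) ⟨v, i, stk (t.code ++ m) a b c⟩ ⟨none, i, stk m a (t.code.reverse ++ b) c⟩
      (7 * t.size + 3) := by
  have h := runs_moveTree (k := .b) (by decide) (by decide) v i t (stk (t.code ++ m) a b c) m
    rfl rfl
  rwa [update_stk_main, update_stk_b] at h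

theorem runs_moveTree_c (v : Register Γ) (i : List Γ) (t : BinTree) (m a b c : List Bool) :
    Runs (moveTree .c) ⟨v, i, stk (t.code ++ m) a b c⟩ ⟨none, i, stk m a b (t.code.reverse ++ c)⟩
      (7 * t.size + 3) := by
  have h := runs_moveTree (k := .c) (by decide) (by decide) v i t (stk (t.code ++ m) a b c) m
    rfl rfl
  rwa [update_stk_main, update_stk_c] at h

theorem runs_pour_a (v : Register Γ) (i : List Γ) (m a b c : List Bool) :
    Runs (pour .a .main) ⟨v, i, stk m a b c⟩ ⟨none, i, stk (a.reverse ++ m) [] b c⟩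
      (3 * a.length + 2) := by
  have h := runs_pour (k := .a) (l := .main) (by decide) v i (stk m a b c)
  rwa [update_stk_main, update_stk_a] at h

theorem runs_pour_b (v : Register Γ) (i : List Γ) (m a b c : List Bool) :
    Runs (pour .b .main) ⟨v, i, stk m a b c⟩ ⟨none, i, stk (b.reverse ++ m) a [] c⟩
      (3 * b.length + 2) := by
  have h := runs_pour (k := .b) (l := .main) (by decide) v i (stk m a b c)
  rwa [update_stk_main, update_stk_b] at h

theorem runs_pour_c (v : Register Γ) (i : List Γ) (m a b c : List Bool) :
    Runs (pour .c .main) ⟨v, i, stk m a b c⟩ ⟨none, i, stk (c.reverse ++ m) a b []⟩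
      (3 * c.length + 2) := by
  have h := runs_pour (k := .c) (l := .main) (by decide) v i (stk m a b c)
  rwa [update_stk_main, update_stk_c] at h

/-- Removes the tree on top of the main stack. -/
def drop : Prog Γ := .seq (moveTree .a) (clear .a)

theorem main_drop (t : BinTree) (m : List Bool) :
    Main (Γ := Γ) drop (t.code ++ m) m (9 * t.size + 5) := fun v i => by
  refine ⟨none, ((runs_moveTree_a v i t m [] [] []).seq (?_ : Runs _ _ _ (2 * t.size + 2))).mono
    (by omega)⟩
  have h := runs_clear .a none i (stk m (t.code.reverse ++ []) [] [])
  rw [update_stk_a] at h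
  simpa [stk] using h

/-- Exchanges the two trees on top of the main stack. -/
def swap : Prog Γ :=
  .seq (moveTree .a) (.seq (moveTree .b) (.seq (pour .a .main) (pour .b .main)))

theorem main_swap (t u : BinTree) (m : List Bool) :
    Main (Γ := Γ) swap (t.code ++ (u.code ++ m)) (u.code ++ (t.code ++ m))
      (10 * t.size + 10 * u.size + 10) := fun v i => by
  have h := (runs_moveTree_a v i t (u.code ++ m) [] [] []).seq ((runs_moveTree_b ..).seq
    ((runs_pour_a ..).seq (runs_pour_b ..)))
  simp only [List.append_nil, List.reverse_reverse, List.length_reverse,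
    BinTree.length_code] at h
  exact ⟨none, h.mono (by omega)⟩

/-- Exchanges the second and the third tree on the main stack. -/
def swapBelow : Prog Γ :=
  .seq (moveTree .a) (.seq (moveTree .b) (.seq (moveTree .c)
    (.seq (pour .b .main) (.seq (pour .c .main) (pour .a .main)))))

theorem main_swapBelow (t u w : BinTree) (m : List Bool) :
    Main (Γ := Γ) swapBelow (t.code ++ (u.code ++ (w.code ++ m)))
      (t.code ++ (w.code ++ (u.code ++ m)))
      (10 * t.size + 10 * u.size + 10 * w.size + 15) := fun v i => by
  have h := (runs_moveTree_a v i t (u.code ++ (w.code ++ m)) [] [] []).seq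
    ((runs_moveTree_b ..).seq ((runs_moveTree_c ..).seq ((runs_pour_b ..).seq
      ((runs_pour_c ..).seq (runs_pour_a ..)))))
  simp only [List.append_nil, List.reverse_reverse, List.length_reverse,
    BinTree.length_code] at h
  exact ⟨none, h.mono (by omega)⟩

/-- Pours the stack `a` onto the main stack and onto the stack `b` at the same time. -/
def pourBoth : Prog Γ :=
  .seq (.pop (some .a))
    (.loop Option.isSome (.seq (pushReg .main) (.seq (pushReg .b) (.pop (some .a)))))

theorem runs_pourBoth (v : Register Γ) (i : List Γ) (m a b c : List Bool) :
    Runs pourBoth ⟨v, i, stk m a b c⟩ ⟨none, i, stk (a.reverse ++ m) [] (a.reverse ++ b) c⟩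
      (4 * a.length + 2) := by
  suffices H : ∀ a m b : List Bool,
      Runs (.loop Option.isSome (.seq (pushReg .main) (.seq (pushReg .b) (.pop (some .a)))))
        ⟨a.head?.map Sum.inl, i, stk m a.tail b c⟩
        ⟨none, i, stk (a.reverse ++ m) [] (a.reverse ++ b) c⟩ (4 * a.length + 1) by
    have h := Runs.pop Work.a v i (stk m a b c)
    rw [update_stk_a] at h
    exact (h.seq (H a m b)).mono (by omega)
  intro a
  induction a with
  | nil => exact fun m b => Runs.loopFalse rfl
  | cons x a ih =>
    intro m b
    have h₁ := Runs.push Work.main isTrue (some (Sum.inl x)) i (stk m a b c)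
    have h₂ := Runs.push Work.b isTrue (some (Sum.inl x)) i (stk (x :: m) a b c)
    have h₃ := Runs.pop Work.a (some (Sum.inl x)) i (stk (x :: m) a (x :: b) c)
    rw [update_stk_main] at h₁
    rw [update_stk_b] at h₂
    rw [update_stk_a] at h₃
    have h := Runs.loopTrue (c := Option.isSome) rfl (h₁.seq (h₂.seq h₃)) (ih (x :: m) (x :: b))
    simp only [List.reverse_cons, List.append_assoc, List.singleton_append]
    exact h.mono (by simp only [List.length_cons]; omega)

/-- Duplicates the tree on top of the main stack. -/
def dup : Prog Γ :=
  .seq (moveTree .a) (.seq pourBoth (.seq (pour .b .a) (pour .a .main)))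

theorem main_dup (t : BinTree) (m : List Bool) :
    Main (Γ := Γ) dup (t.code ++ m) (t.code ++ (t.code ++ m)) (17 * t.size + 9) := fun v i => by
  have h₀ := runs_pour (Γ := Γ) (k := .b) (l := .a) (by decide) none i
    (stk (t.code ++ m) [] t.code [])
  rw [update_stk_a, update_stk_b] at h₀
  have h₁ := runs_moveTree_a v i t m [] [] []
  have h₂ := runs_pourBoth (Γ := Γ) none i m t.code.reverse [] []
  simp only [List.append_nil, List.reverse_reverse] at h₁ h₂
  have h := h₁.seq (h₂.seq (h₀.seq (runs_pour_a ..)))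
  simp only [List.append_nil, List.reverse_reverse, List.length_reverse, stk,
    BinTree.length_code] at h
  exact ⟨none, h.mono (by omega)⟩

end StackProg

/-! ### Polynomial-time functions -/

namespace StackProg

/-- Types whose elements are represented by binary trees. -/
class Enc (α : Type) where
  /-- the tree that represents an element -/
  enc : α → BinTree

open Enc (enc)

variable {α β γ δ σ : Type} [Enc α] [Enc β] [Enc γ] [Enc δ] [Enc σ]

/-- The size of the representation of an element. -/
def size (a : α) : ℕ := (enc a).size

/-- A function is polynomial-time computable if some program replaces the code of its argument on
top of the main stack by the code of its value, in a number of steps that is polynomial in the size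
of the argument. The bound on the size of the value, which would follow, is included. The alphabet
of the input stack is arbitrary, as that stack is not used. -/
@[fun_prop]
def PolyTime (f : α → β) : Prop :=
  ∀ Γ : Type, ∃ (p : Prog Γ) (q : Polynomial ℕ), ∀ a,
    (∀ m, Main p ((enc a).code ++ m) ((enc (f a)).code ++ m) (q.eval (size a))) ∧
      size (f a) ≤ q.eval (size a)

theorem eval_mono (q : Polynomial ℕ) {m n : ℕ} (h : m ≤ n) : q.eval m ≤ q.eval n := by
  induction q using Polynomial.induction_on' with
  | add p q hp hq => simpa only [Polynomial.eval_add] using Nat.add_le_add hp hq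
  | monomial k a =>
    simpa only [Polynomial.eval_monomial] using Nat.mul_le_mul_left _ (Nat.pow_le_pow_left h k)

namespace PolyTime

@[fun_prop]
theorem id : PolyTime fun a : α => a := fun Γ =>
  ⟨.seq (pushBit .main true) (.pop (some .main)), .X + 2, fun a => by
    simp only [Polynomial.eval_add, Polynomial.eval_X, Polynomial.eval_ofNat]
    exact ⟨fun m => ((main_pushBit true _).seq (main_pop _ _)).mono (by omega), by omega⟩⟩

@[fun_prop]
theorem comp {f : β → γ} {g : α → β} (hf : PolyTime f) (hg : PolyTime g) :
    PolyTime fun a => f (g a) := fun Γ => by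
  obtain ⟨p, q, h⟩ := hf Γ
  obtain ⟨p', q', h'⟩ := hg Γ
  refine ⟨.seq p' p, q' + q.comp q', fun a => ?_⟩
  have h₁ := eval_mono q (h' a).2
  simp only [Polynomial.eval_add, Polynomial.eval_comp]
  exact ⟨fun m => (((h' a).1 m).seq ((h (g a)).1 m)).mono (by omega), by
    have := (h (g a)).2; omega⟩

/-- Pushes a fixed tree. -/
def pushTree {Γ : Type} : BinTree → Prog Γ
  | .leaf => pushBit .main false
  | .node a b => .seq (pushTree b) (.seq (pushTree a) (pushBit .main true))

theorem main_pushTree {Γ : Type} (t : BinTree) (m : List Bool) :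
    Main (Γ := Γ) (pushTree t) m (t.code ++ m) t.size := by
  induction t generalizing m with
  | leaf => exact main_pushBit false m
  | node a b iha ihb =>
    have h := (ihb m).seq ((iha (b.code ++ m)).seq (main_pushBit true _))
    rw [← List.append_assoc] at h
    exact h.mono (by simp only [BinTree.size]; omega)

@[fun_prop]
theorem const (b : β) : PolyTime fun _ : α => b := fun Γ => by
  refine ⟨.seq drop (pushTree (enc b)), 9 * .X + 5 + .C (size b), fun a => ?_⟩
  simp only [Polynomial.eval_add, Polynomial.eval_X, Polynomial.eval_ofNat, Polynomial.eval_mul,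
    Polynomial.eval_C]
  exact ⟨fun m => ((main_drop _ m).seq (main_pushTree _ _)).mono (by unfold size; omega), by omega⟩

instance : Enc (α × β) := ⟨fun a => .node (enc a.1) (enc a.2)⟩

@[fun_prop]
theorem prodMk {f : α → β} {g : α → γ} (hf : PolyTime f) (hg : PolyTime g) :
    PolyTime fun a => (f a, g a) := fun Γ => by
  obtain ⟨p, q, h⟩ := hf Γ
  obtain ⟨p', q', h'⟩ := hg Γ
  refine ⟨.seq dup (.seq p' (.seq swap (.seq p (pushBit .main true)))),
    30 * .X + 11 * q + 11 * q' + 21, fun a => ?_⟩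
  have h₁ := (h' a).2
  have h₂ := (h a).2
  simp only [Polynomial.eval_add, Polynomial.eval_X, Polynomial.eval_ofNat, Polynomial.eval_mul]
  refine ⟨fun m => ?_, ?_⟩
  · have := (main_dup (enc a) m).seq (((h' a).1 _).seq ((main_swap _ _ m).seq (((h a).1 _).seq
      (main_pushBit true _))))
    rw [← List.append_assoc] at this
    exact this.mono (by unfold size at *; omega)
  · change size (f a) + size (g a) + 1 ≤ _
    omega

theorem fst' : PolyTime fun p : α × β => p.1 := fun Γ => by
  refine ⟨.seq (.pop (some .main)) (.seq swap drop), 20 * .X + 20, fun p => ?_⟩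
  simp only [Polynomial.eval_add, Polynomial.eval_X, Polynomial.eval_ofNat, Polynomial.eval_mul]
  have e : size p = size p.1 + size p.2 + 1 := rfl
  refine ⟨fun m => ?_, by omega⟩
  have := (main_pop (Γ := Γ) true ((enc p.1).code ++ ((enc p.2).code ++ m))).seq
    ((main_swap _ _ m).seq (main_drop _ _))
  rw [← List.append_assoc] at this
  exact this.mono (by rw [e]; unfold size at *; omega)

theorem snd' : PolyTime fun p : α × β => p.2 := fun Γ => by
  refine ⟨.seq (.pop (some .main)) drop, 20 * .X + 20, fun p => ?_⟩
  simp only [Polynomial.eval_add, Polynomial.eval_X, Polynomial.eval_ofNat, Polynomial.eval_mul]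
  have e : size p = size p.1 + size p.2 + 1 := rfl
  refine ⟨fun m => ?_, by omega⟩
  have := (main_pop (Γ := Γ) true ((enc p.1).code ++ ((enc p.2).code ++ m))).seq (main_drop _ _)
  rw [← List.append_assoc] at this
  exact this.mono (by rw [e]; unfold size at *; omega)

@[fun_prop]
theorem fst {f : α → β × γ} (hf : PolyTime f) : PolyTime fun a => (f a).1 := fst'.comp hf

@[fun_prop]
theorem snd {f : α → β × γ} (hf : PolyTime f) : PolyTime fun a => (f a).2 := snd'.comp hf

instance : Enc Unit := ⟨fun _ => .leaf⟩

/-- The two bits are represented by trees of the same size, so that the size of a word is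
determined by its length. -/
instance : Enc Bool := ⟨fun b => bif b then .node (.node .leaf .leaf) .leaf
  else .node .leaf (.node .leaf .leaf)⟩

/-- Removes three bits from the main stack. -/
def popThree {Γ : Type} : Prog Γ :=
  .seq (.pop (some .main)) (.seq (.pop (some .main)) (.pop (some .main)))

theorem main_popThree {Γ : Type} (x y z : Bool) (m : List Bool) :
    Main (Γ := Γ) popThree (x :: y :: z :: m) m 3 :=
  (main_pop _ _).seq ((main_pop _ _).seq (main_pop _ _))

@[fun_prop]
theorem cond {c : α → Bool} {f g : α → β} (hc : PolyTime c) (hf : PolyTime f) (hg : PolyTime g) :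
    PolyTime fun a => bif c a then f a else g a := fun Γ => by
  obtain ⟨r, q'', h''⟩ := hc Γ
  obtain ⟨p, q, h⟩ := hf Γ
  obtain ⟨p', q', h'⟩ := hg Γ
  refine ⟨.seq dup (.seq r (.seq (.pop (some .main))
    (popIte (.seq popThree p) (.seq popThree p')))), 17 * .X + q + q' + q'' + 20, fun a => ?_⟩
  have h₁ := (h' a).2
  have h₂ := (h a).2
  have h₃ := (h'' a).1
  simp only [Polynomial.eval_add, Polynomial.eval_X, Polynomial.eval_ofNat, Polynomial.eval_mul]
  refine ⟨fun m => ?_, ?_⟩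
  · cases hca : c a with
    | false =>
      rw [hca] at h₃
      exact ((main_dup _ _).seq ((h₃ _).seq ((main_pop _ _).seq
        ((main_popThree _ _ _ _).seq ((h' a).1 m)).popIte_false))).mono
        (by unfold size at *; omega)
    | true =>
      rw [hca] at h₃
      exact ((main_dup _ _).seq ((h₃ _).seq ((main_pop _ _).seq
        ((main_popThree _ _ _ _).seq ((h a).1 m)).popIte_true))).mono
        (by unfold size at *; omega)
  · cases c a <;> simp only [cond_true, cond_false] <;> omega

end PolyTime

/-- Lists are represented like nested pairs. -/
def encList : List α → BinTree
  | [] => .leaf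
  | a :: l => .node (enc a) (encList l)

instance : Enc (List α) := ⟨encList⟩

theorem size_nil : size ([] : List α) = 1 := rfl

theorem size_cons (a : α) (l : List α) : size (a :: l) = size a + size l + 1 := rfl

theorem size_prod (p : α × β) : size p = size p.1 + size p.2 + 1 := rfl

theorem size_mk (a : α) (b : β) : size (a, b) = size a + size b + 1 := rfl

theorem size_unit (a : Unit) : size a = 1 := rfl

theorem size_bool (b : Bool) : size b = 5 := by
  cases b <;> rfl

theorem length_lt_size (l : List α) : l.length < size l := by
  induction l with
  | nil => simp [size_nil]
  | cons a l ih => rw [size_cons, List.length_cons]; omega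

namespace PolyTime

theorem cons {f : α → β} {g : α → List β} (hf : PolyTime f) (hg : PolyTime g) :
    PolyTime fun a => f a :: g a :=
  prodMk hf hg

attribute [fun_prop] cons

theorem listCases {l : α → List β} {f : α → γ} {g : α × (β × List β) → γ} (hl : PolyTime l)
    (hf : PolyTime f) (hg : PolyTime g) :
    PolyTime fun a => match l a with
      | [] => f a
      | b :: t => g (a, (b, t)) := fun Γ => by
  obtain ⟨r, q'', h''⟩ := hl Γ
  obtain ⟨p, q, h⟩ := hf Γ
  obtain ⟨p', q', h'⟩ := hg Γ
  refine ⟨.seq dup (.seq r (popIte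
      (.seq (pushBit .main true) (.seq swap (.seq (pushBit .main true) p'))) p)),
    30 * .X + q + q'.comp (.X + q'' + 1) + 11 * q'' + 25, fun a => ?_⟩
  have h₁ := (h a).2
  have h₂ := (h'' a).2
  simp only [Polynomial.eval_add, Polynomial.eval_X, Polynomial.eval_ofNat, Polynomial.eval_mul,
    Polynomial.eval_comp, Polynomial.eval_one]
  have h₄ := (h'' a).1
  cases hla : l a with
  | nil =>
    rw [hla] at h₂ h₄
    refine ⟨fun m => ?_, by dsimp only; omega⟩
    exact ((main_dup _ _).seq ((h₄ _).seq ((h a).1 m).popIte_false)).mono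
        (by unfold size at *; omega)
  | cons b t =>
    rw [hla] at h₂ h₄
    have h₅ := (h' (a, (b, t))).2
    have h₆ : size (a, (b, t)) ≤ size a + Polynomial.eval (size a) q'' + 1 := by
      rw [size_mk, size_mk]; rw [size_cons] at h₂; omega
    have h₇ := eval_mono q' h₆
    refine ⟨fun m => ?_, by dsimp only; omega⟩
    have h₈ := (main_swap (Γ := Γ) (.node (enc b) (encList t)) (enc a) m).seq
      ((main_pushBit true _).seq (by
        have := (h' (a, (b, t))).1 m
        rwa [show (enc (a, (b, t))).code ++ m = true :: ((enc a).code ++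
          ((BinTree.node (enc b) (encList t)).code ++ m)) from by
            simp [enc, BinTree.code]] at this))
    have h₉ : BinTree.size (.node (enc b) (encList t)) = size (b :: t) := rfl
    rw [h₉] at h₈
    refine ((main_dup _ _).seq ((h₄ _).seq (Main.popIte_true
        (t := 1 + (10 * (size (b :: t)) + 10 * size a + 10 + (1 + (q'.eval (size (a, (b, t)))))))
        ?_))).mono
        (by unfold size at *; omega)
    have := (main_pushBit (Γ := Γ) true ((enc b).code ++ (encList t).code ++ (enc a).code ++ m)).seq
      (by simpa [BinTree.code] using h₈)
    simpa [size] using this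

/-- Pops bits and runs `p`, as long as the bits are `1`. -/
def popLoop {Γ : Type} (p : Prog Γ) : Prog Γ :=
  .seq (.pop (some .main)) (.loop isTrue (.seq p (.pop (some .main))))

/-- The body of the loop that folds `p` over a list: below the head and the tail of the list, the
main stack holds the accumulated value. -/
def foldBody {Γ : Type} (p : Prog Γ) : Prog Γ :=
  .seq swapBelow (.seq swap (.seq (pushBit .main true) (.seq p swap)))

theorem main_foldBody {Γ : Type} {p : Prog Γ} {q : Polynomial ℕ} {f : σ × β → σ} {s : σ} {b : β}
    (hp : ∀ m, Main p ((enc (s, b)).code ++ m) ((enc (f (s, b))).code ++ m) (q.eval (size (s, b))))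
    (l : List β) (m : List Bool) {N : ℕ} (h₁ : size (b :: l) ≤ N) (h₂ : size s ≤ N)
    (h₃ : size (f (s, b)) ≤ N) :
    Main (foldBody p) ((enc b).code ++ ((enc l).code ++ ((enc s).code ++ m)))
      ((enc l).code ++ ((enc (f (s, b))).code ++ m)) (q.eval (2 * N) + 60 * N + 40) := by
  have h₄ : Main p (true :: ((enc s).code ++ ((enc b).code ++ ((enc l).code ++ m))))
      ((enc (f (s, b))).code ++ ((enc l).code ++ m)) (q.eval (size (s, b))) := by
    have := hp ((enc l).code ++ m)
    rwa [show (enc (s, b)).code = true :: ((enc s).code ++ (enc b).code) from rfl,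
      List.cons_append, List.append_assoc] at this
  have h := (main_swapBelow (Γ := Γ) (enc b) (enc l) (enc s) m).seq ((main_swap _ _ _).seq
    ((main_pushBit true _).seq (h₄.seq (main_swap (enc (f (s, b))) (enc l) m))))
  rw [size_cons] at h₁
  have := eval_mono q (m := size (s, b)) (n := 2 * N) (by rw [size_mk]; omega)
  exact h.mono (by unfold size at *; omega)

theorem runs_fold {Γ : Type} {p : Prog Γ} {q : Polynomial ℕ} {f : σ × β → σ}
    (hp : ∀ a m, Main p ((enc a).code ++ m) ((enc (f a)).code ++ m) (q.eval (size a)))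
    (i : List Γ) {N : ℕ} (m : List Bool) (l : List β) : ∀ s : σ, size l ≤ N →
      (∀ l', l' <+: l → size (l'.foldl (fun s b => f (s, b)) s) ≤ N) → ∀ v, ∃ v',
        Runs (popLoop (foldBody p)) ⟨v, i, stk ((enc l).code ++ ((enc s).code ++ m))⟩
          ⟨v', i, stk ((enc (l.foldl (fun s b => f (s, b)) s)).code ++ m)⟩
          (l.length * (q.eval (2 * N) + 60 * N + 42) + 2) := by
  suffices H : ∀ s : σ, size l ≤ N →
      (∀ l', l' <+: l → size (l'.foldl (fun s b => f (s, b)) s) ≤ N) → ∃ v',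
        Runs (.loop isTrue (.seq (foldBody p) (.pop (some .main))))
          ⟨(enc l).code.head?.map Sum.inl, i, stk ((enc l).code.tail ++ ((enc s).code ++ m))⟩
          ⟨v', i, stk ((enc (l.foldl (fun s b => f (s, b)) s)).code ++ m)⟩
          (l.length * (q.eval (2 * N) + 60 * N + 42) + 1) by
    intro s h₁ h₂ v
    obtain ⟨v', h⟩ := H s h₁ h₂
    have h₃ := Runs.pop .main v i (stk ((enc l).code ++ ((enc s).code ++ m)))
    rw [update_stk_main] at h₃
    refine ⟨v', (h₃.seq (h.of_eq ?_ ?_)).mono (by omega)⟩ <;> cases l <;> rfl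
  induction l with
  | nil => exact fun s _ _ => ⟨_, (Runs.loopFalse rfl).mono (by omega)⟩
  | cons b l ih =>
    intro s h₁ h₂
    have h₃ : size s ≤ N := h₂ [] List.nil_prefix
    have h₄ : size (f (s, b)) ≤ N := h₂ [b] (by simp)
    obtain ⟨v', h⟩ := ih (f (s, b)) (by rw [size_cons] at h₁; omega)
      (fun l' hl' => h₂ (b :: l') (by simpa using hl'))
    obtain ⟨w, h₅⟩ := main_foldBody (hp (s, b)) l m h₁ h₃ h₄ (some (Sum.inl true)) i
    have h₆ := Runs.pop .main w i (stk ((enc l).code ++ ((enc (f (s, b))).code ++ m)))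
    rw [update_stk_main] at h₆
    have h₇ : (b :: l).length * (q.eval (2 * N) + 60 * N + 42) =
        l.length * (q.eval (2 * N) + 60 * N + 42) + (q.eval (2 * N) + 60 * N + 42) := by
      rw [List.length_cons]; ring
    have h₈ := (h₅.seq h₆).of_eq (v := (enc (b :: l)).code.head?.map Sum.inl)
      (s := stk ((enc (b :: l)).code.tail ++ ((enc s).code ++ m))) rfl (by
        rw [show (enc (b :: l)).code.tail = (enc b).code ++ (enc l).code from rfl,
          List.append_assoc])
    refine ⟨v', (Runs.loopTrue rfl h₈ (h.of_eq ?_ ?_)).mono (by rw [h₇]; omega)⟩ <;>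
      cases l <;> rfl

/-- Folding over a list is a polynomial-time operation if all intermediate values are of polynomial
size. -/
theorem foldl {l : α → List β} {s : α → σ} {f : α × (σ × β) → σ} (hl : PolyTime l)
    (hs : PolyTime s) (hf : PolyTime f) (B : Polynomial ℕ)
    (hB : ∀ a l', l' <+: l a → size (l'.foldl (fun s b => f (a, (s, b))) (s a)) ≤ B.eval (size a)) :
    PolyTime fun a => (l a).foldl (fun s b => f (a, (s, b))) (s a) := by
  suffices H : PolyTime fun a => (l a).foldl
      (fun (s : α × σ) b => (fun p : (α × σ) × β => (p.1.1, f (p.1.1, (p.1.2, p.2)))) (s, b))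
      (a, s a) by
    have h : ∀ a (l : List β) s, l.foldl (fun (s : α × σ) b => (s.1, f (s.1, (s.2, b)))) (a, s) =
        (a, l.foldl (fun s b => f (a, (s, b))) s) := by
      intro a l
      induction l with
      | nil => intro s; rfl
      | cons b l ih => intro s; exact ih _
    simpa only [h] using H.snd
  intro Γ
  obtain ⟨p, q, hp⟩ := (show PolyTime fun p : (α × σ) × β => (p.1.1, f (p.1.1, (p.1.2, p.2))) by
    fun_prop) Γ
  obtain ⟨p₁, q₁, h₁⟩ := hl Γ
  obtain ⟨p₂, q₂, h₂⟩ := (show PolyTime fun a => (a, s a) by fun_prop) Γ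
  let N : Polynomial ℕ := q₁ + .X + B + 1
  refine ⟨.seq (.seq dup (.seq p₂ (.seq swap p₁))) (popLoop (foldBody p)),
    27 * .X + 22 + 11 * q₂ + q₁ + N * (q.comp (2 * N) + 60 * N + 42) + N, fun a => ?_⟩
  have hN : N.eval (size a) = q₁.eval (size a) + size a + B.eval (size a) + 1 := by
    simp [N]
  simp only [Polynomial.eval_add, Polynomial.eval_X, Polynomial.eval_ofNat, Polynomial.eval_mul,
    Polynomial.eval_comp]
  generalize N.eval (size a) = n at hN
  have h : ∀ (l : List β) s, l.foldl
      (fun (s : α × σ) b => (fun p : (α × σ) × β => (p.1.1, f (p.1.1, (p.1.2, p.2)))) (s, b))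
      (a, s) = (a, l.foldl (fun s b => f (a, (s, b))) s) := by
    intro l
    induction l with
    | nil => intro s; rfl
    | cons b l ih => intro s; exact ih _
  have hl' := (h₁ a).2
  have hs' := (h₂ a).2
  refine ⟨fun m v i => ?_, ?_⟩
  · obtain ⟨v₁, h₃⟩ := ((main_dup _ m).seq (((h₂ a).1 _).seq ((main_swap _ _ _).seq
      ((h₁ a).1 _)))) v i
    obtain ⟨v₂, h₄⟩ := runs_fold (fun a => (hp a).1) i (N := n) m (l a) (a, s a) (by omega)
      (fun l' hl' => by
        rw [h, size_mk]
        have := hB a l' hl'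
        omega) v₁
    have h₅ := Nat.mul_le_mul_right (q.eval (2 * n) + 60 * n + 42)
      (show (l a).length ≤ n by have := length_lt_size (l a); omega)
    exact ⟨v₂, (h₃.seq h₄).mono (by unfold size at *; omega)⟩
  · rw [h, size_mk]
    have := hB a (l a) List.prefix_rfl
    omega

end PolyTime
end StackProg

/-! ### Polynomial-time operations on lists and natural numbers -/

namespace StackProg

open Enc (enc)

variable {α β γ δ σ : Type} [Enc α] [Enc β] [Enc γ] [Enc δ] [Enc σ]

theorem size_le_of_mem {b : β} {l : List β} (h : b ∈ l) : size b ≤ size l := by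
  induction l with
  | nil => simp at h
  | cons a l ih =>
    rw [size_cons]
    rcases List.mem_cons.1 h with rfl | h
    · omega
    · have := ih h; omega

theorem size_append (l l' : List β) : size (l ++ l') + 1 = size l + size l' := by
  induction l with
  | nil => simp [size_nil, Nat.add_comm]
  | cons a l ih => rw [List.cons_append, size_cons, size_cons]; omega

theorem size_reverse (l : List β) : size l.reverse = size l := by
  induction l with
  | nil => rfl
  | cons a l ih =>
    have := size_append l.reverse [a]
    rw [List.reverse_cons, size_cons]
    rw [size_cons, size_nil] at this
    omega

theorem size_tail_le (l : List β) : size l.tail ≤ size l := by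
  cases l with
  | nil => exact le_rfl
  | cons a l => rw [size_cons]; exact Nat.le_succ_of_le (Nat.le_add_left ..)

namespace PolyTime

theorem exists_size_le {f : α → β} (hf : PolyTime f) :
    ∃ q : Polynomial ℕ, ∀ a, size (f a) ≤ q.eval (size a) := by
  obtain ⟨_, q, h⟩ := hf Unit
  exact ⟨q, fun a => (h a).2⟩

/-- A function that does not change the representation is computed by a program that restores the
stacks. -/
theorem of_enc {f : α → β} (h : ∀ a, enc (f a) = enc a) : PolyTime f := fun Γ => by
  obtain ⟨p, q, hp⟩ := (id : PolyTime fun a : α => a) Γ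
  refine ⟨p, q, fun a => ?_⟩
  unfold size
  rw [h]
  exact hp a

/-- Folding over a list is a polynomial-time operation if every step adds to the size of the
accumulated value at most a polynomial in the sizes of the other data. -/
theorem foldl_of_size_le {l : α → List β} {s : α → σ} {f : α → σ → β → σ} (hl : PolyTime l)
    (hs : PolyTime s) (hf : PolyTime fun p : α × (σ × β) => f p.1 p.2.1 p.2.2) (C : Polynomial ℕ)
    (hC : ∀ a s b, size (f a s b) ≤ size s + C.eval (size a + size b)) :
    PolyTime fun a => (l a).foldl (f a) (s a) := by
  obtain ⟨ql, hql⟩ := hl.exists_size_le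
  obtain ⟨qs, hqs⟩ := hs.exists_size_le
  refine foldl (f := fun p => f p.1 p.2.1 p.2.2) hl hs hf (qs + ql * C.comp (.X + ql))
    fun a l' hl' => ?_
  simp only [Polynomial.eval_add, Polynomial.eval_mul, Polynomial.eval_comp, Polynomial.eval_X]
  have h₁ : ∀ b ∈ l', size b ≤ ql.eval (size a) := fun b hb =>
    (size_le_of_mem (hl'.subset hb)).trans (hql a)
  have h₂ : ∀ (l' : List β) s, (∀ b ∈ l', size b ≤ ql.eval (size a)) →
      size (l'.foldl (f a) s) ≤ size s + l'.length * C.eval (size a + ql.eval (size a)) := by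
    intro l'
    induction l' with
    | nil => intro s _; simp
    | cons b l' ih =>
      intro s hb
      have h₃ := ih (f a s b) fun c hc => hb c (List.mem_cons_of_mem _ hc)
      have h₄ := hC a s b
      have h₅ := eval_mono C (Nat.add_le_add_left (hb b List.mem_cons_self) (size a))
      rw [List.foldl_cons, List.length_cons, Nat.succ_mul]
      omega
  have h₃ := h₂ l' (s a) h₁
  have h₄ : l'.length ≤ ql.eval (size a) :=
    hl'.length_le.trans ((length_lt_size _).le.trans (hql a))
  have h₅ := Nat.mul_le_mul_right (C.eval (size a + ql.eval (size a))) h₄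
  have h₆ := hqs a
  exact h₃.trans (Nat.add_le_add h₆ h₅)

@[fun_prop]
theorem and {f g : α → Bool} (hf : PolyTime f) (hg : PolyTime g) :
    PolyTime fun a => f a && g a := by
  have h : (fun a => f a && g a) = fun a => bif f a then g a else false := by
    funext a; cases f a <;> rfl
  rw [h]
  fun_prop

@[fun_prop]
theorem or {f g : α → Bool} (hf : PolyTime f) (hg : PolyTime g) :
    PolyTime fun a => f a || g a := by
  have h : (fun a => f a || g a) = fun a => bif f a then true else g a := by
    funext a; cases f a <;> rfl
  rw [h]
  fun_prop

@[fun_prop]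
theorem not {f : α → Bool} (hf : PolyTime f) : PolyTime fun a => !f a := by
  have h : (fun a => !f a) = fun a => bif f a then false else true := by
    funext a; cases f a <;> rfl
  rw [h]
  fun_prop

@[fun_prop]
theorem boolBeq {f g : α → Bool} (hf : PolyTime f) (hg : PolyTime g) :
    PolyTime fun a => f a == g a := by
  have h : (fun a => f a == g a) = fun a => bif f a then g a else !g a := by
    funext a; cases f a <;> cases g a <;> rfl
  rw [h]
  fun_prop

@[fun_prop]
theorem tail {l : α → List β} (hl : PolyTime l) : PolyTime fun a => (l a).tail := by
  have h := listCases (f := fun _ => ([] : List β)) (g := fun p => p.2.2) hl (by fun_prop)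
    (by fun_prop)
  refine cast (congrArg PolyTime (funext fun a => ?_)) h
  cases l a <;> rfl

@[fun_prop]
theorem headD {l : α → List β} {d : α → β} (hl : PolyTime l) (hd : PolyTime d) :
    PolyTime fun a => (l a).headD (d a) := by
  have h := listCases (f := fun a => d a) (g := fun p => p.2.1) hl (by fun_prop) (by fun_prop)
  refine cast (congrArg PolyTime (funext fun a => ?_)) h
  cases l a <;> rfl

@[fun_prop]
theorem isEmpty {l : α → List β} (hl : PolyTime l) : PolyTime fun a => (l a).isEmpty := by
  have h := listCases (f := fun _ => true) (g := fun _ => false) hl (by fun_prop) (by fun_prop)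
  refine cast (congrArg PolyTime (funext fun a => ?_)) h
  cases l a <;> rfl

@[fun_prop]
theorem reverse {l : α → List β} (hl : PolyTime l) : PolyTime fun a => (l a).reverse := by
  have h := foldl_of_size_le (s := fun _ => []) (f := fun _ s b => b :: s) hl (by fun_prop)
    (by fun_prop) (.X + 1) fun a s b => by
      simp only [size_cons, Polynomial.eval_add, Polynomial.eval_X, Polynomial.eval_one]
      omega
  simpa using h

/-- Folding from the right, with the growth condition of `foldl_of_size_le`. -/
theorem foldr_of_size_le {l : α → List β} {s : α → σ} {f : α → β → σ → σ} (hl : PolyTime l)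
    (hs : PolyTime s) (hf : PolyTime fun p : α × (σ × β) => f p.1 p.2.2 p.2.1) (C : Polynomial ℕ)
    (hC : ∀ a s b, size (f a b s) ≤ size s + C.eval (size a + size b)) :
    PolyTime fun a => (l a).foldr (f a) (s a) := by
  have h := foldl_of_size_le (f := fun a s b => f a b s) hl.reverse hs hf C hC
  simpa only [List.foldl_reverse] using h

@[fun_prop]
theorem append {l l' : α → List β} (hl : PolyTime l) (hl' : PolyTime l') :
    PolyTime fun a => l a ++ l' a := by
  have h := foldr_of_size_le (f := fun _ b s => b :: s) hl hl' (by fun_prop) (.X + 1)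
    fun a s b => by
      simp only [size_cons, Polynomial.eval_add, Polynomial.eval_X, Polynomial.eval_one]
      omega
  simpa using h

theorem map {l : α → List β} {f : α → β → γ} (hl : PolyTime l)
    (hf : PolyTime fun p : α × β => f p.1 p.2) : PolyTime fun a => (l a).map (f a) := by
  obtain ⟨q, hq⟩ := hf.exists_size_le
  have h := foldr_of_size_le (s := fun _ => []) (f := fun a b s => f a b :: s) hl (by fun_prop)
    (cons (hf.comp (g := fun p : α × (List γ × β) => (p.1, p.2.2)) (by fun_prop)) (by fun_prop))
    (q.comp (.X + 1) + 1) fun a s b => by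
      have : size (f a b) ≤ _ := hq (a, b)
      rw [size_mk] at this
      simp only [size_cons, Polynomial.eval_add, Polynomial.eval_X, Polynomial.eval_one,
        Polynomial.eval_comp]
      omega
  simpa using h

theorem filter {l : α → List β} {f : α → β → Bool} (hl : PolyTime l)
    (hf : PolyTime fun p : α × β => f p.1 p.2) : PolyTime fun a => (l a).filter (f a) := by
  have h := foldr_of_size_le (s := fun _ => []) (f := fun a b s => bif f a b then b :: s else s)
    hl (by fun_prop)
    (cond (hf.comp (g := fun p : α × (List β × β) => (p.1, p.2.2)) (by fun_prop)) (by fun_prop)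
      (by fun_prop)) (.X + 1) fun a s b => by
      simp only [Polynomial.eval_add, Polynomial.eval_X, Polynomial.eval_one]
      cases f a b <;> simp only [cond_true, cond_false, size_cons] <;> omega
  refine cast (congrArg PolyTime (funext fun a => ?_)) h
  induction l a with
  | nil => rfl
  | cons b t ih =>
    rw [List.foldr_cons, ih, List.filter_cons]
    cases f a b <;> rfl

theorem any {l : α → List β} {f : α → β → Bool} (hl : PolyTime l)
    (hf : PolyTime fun p : α × β => f p.1 p.2) : PolyTime fun a => (l a).any (f a) := by
  have h := foldr_of_size_le (s := fun _ => false) (f := fun a b s => f a b || s)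
    hl (by fun_prop)
    (or (hf.comp (g := fun p : α × (Bool × β) => (p.1, p.2.2)) (by fun_prop)) (by fun_prop))
    0 fun a s b => by simp [size_bool]
  refine cast (congrArg PolyTime (funext fun a => ?_)) h
  induction l a with
  | nil => rfl
  | cons b t ih => rw [List.foldr_cons, ih, List.any_cons]

theorem all {l : α → List β} {f : α → β → Bool} (hl : PolyTime l)
    (hf : PolyTime fun p : α × β => f p.1 p.2) : PolyTime fun a => (l a).all (f a) := by
  have h := foldr_of_size_le (s := fun _ => true) (f := fun a b s => f a b && s)
    hl (by fun_prop)
    (and (hf.comp (g := fun p : α × (Bool × β) => (p.1, p.2.2)) (by fun_prop)) (by fun_prop))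
    0 fun a s b => by simp [size_bool]
  refine cast (congrArg PolyTime (funext fun a => ?_)) h
  induction l a with
  | nil => rfl
  | cons b t ih => rw [List.foldr_cons, ih, List.all_cons]

end PolyTime

/-- Natural numbers are represented in unary; here they only occur as indices. -/
instance : Enc ℕ := ⟨fun n => enc (List.replicate n ())⟩

theorem size_nat (n : ℕ) : size n = 2 * n + 1 := by
  change size (List.replicate n ()) = _
  induction n with
  | zero => rfl
  | succ n ih => rw [List.replicate_succ, size_cons, size_unit]; omega

namespace PolyTime

@[fun_prop]
theorem succ {f : α → ℕ} (hf : PolyTime f) : PolyTime fun a => f a + 1 :=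
  cons (f := fun _ => ()) (g := fun a => List.replicate (f a) ()) (const ())
    ((of_enc (f := fun n : ℕ => List.replicate n ()) fun _ => rfl).comp hf)

/-- The numbers below the length of a list. -/
@[fun_prop]
theorem range_length {l : α → List β} (hl : PolyTime l) :
    PolyTime fun a => List.range (l a).length := by
  obtain ⟨q, hq⟩ := hl.exists_size_le
  have h₀ : ∀ l : List β, l.foldl (fun (s : ℕ × List ℕ) _ => (s.1 + 1, s.1 :: s.2)) (0, []) =
      (l.length, (List.range l.length).reverse) := by
    intro l
    induction l using List.reverseRecOn with
    | nil => rfl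
    | append_singleton l b ih => simp [ih, List.range_succ]
  have h₁ : ∀ n, size (List.range n) ≤ 2 * n * n + 1 := by
    intro n
    induction n with
    | zero => simp [size_nil]
    | succ n ih =>
      have := size_append (List.range n) [n]
      rw [size_cons, size_nil, size_nat] at this
      rw [List.range_succ]
      nlinarith
  have h := foldl (s := fun _ => ((0, []) : ℕ × List ℕ))
    (f := fun p => (p.2.1.1 + 1, p.2.1.1 :: p.2.1.2)) hl
    (by fun_prop) (by fun_prop) (2 * q + 2 * q * q + 3) fun a l' hl' => by
      rw [h₀, size_mk, size_nat, size_reverse]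
      simp only [Polynomial.eval_add, Polynomial.eval_mul, Polynomial.eval_ofNat]
      have h₂ := h₁ l'.length
      have h₃ : l'.length ≤ q.eval (size a) :=
        hl'.length_le.trans ((length_lt_size _).le.trans (hq a))
      nlinarith [Nat.mul_le_mul h₃ h₃]
  simpa only [h₀, List.reverse_reverse] using h.snd.reverse

@[fun_prop]
theorem drop {n : α → ℕ} {l : α → List β} (hn : PolyTime n) (hl : PolyTime l) :
    PolyTime fun a => (l a).drop (n a) := by
  have h := foldl_of_size_le (f := fun _ s _ => s.tail)
    ((of_enc (f := fun n : ℕ => List.replicate n ()) fun _ => rfl).comp hn) hl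
    (by fun_prop) 0 fun a s b => by simpa using size_tail_le s
  refine cast (congrArg PolyTime (funext fun a => ?_)) h
  generalize l a = l
  induction n a generalizing l with
  | zero => rfl
  | succ n ih => rw [List.replicate_succ, List.foldl_cons, ih, List.drop_tail, Nat.add_comm]

@[fun_prop]
theorem getD {n : α → ℕ} {l : α → List β} {d : α → β} (hl : PolyTime l) (hn : PolyTime n)
    (hd : PolyTime d) : PolyTime fun a => (l a).getD (n a) (d a) := by
  have h := (hn.drop hl).headD hd
  refine cast (congrArg PolyTime (funext fun a => ?_)) h
  simp [List.headD_eq_head?_getD]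

@[fun_prop]
theorem natBeq {m n : α → ℕ} (hm : PolyTime m) (hn : PolyTime n) :
    PolyTime fun a => m a == n a := by
  have hu := (of_enc (f := fun n : ℕ => List.replicate n ()) fun _ => rfl)
  have h := (hm.drop (hu.comp hn)).isEmpty.and (hn.drop (hu.comp hm)).isEmpty
  refine cast (congrArg PolyTime (funext fun a => ?_)) h
  rw [Bool.eq_iff_iff]
  simp
  omega

end PolyTime

end StackProg

/-! ### Binary arithmetic and the comparison of fractions -/

namespace StackProg

open Enc (enc)

variable {α β γ δ σ : Type} [Enc α] [Enc β] [Enc γ] [Enc δ] [Enc σ]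

/-- The number with the given binary digits, the least significant digit coming first. -/
def binVal : List Bool → ℕ
  | [] => 0
  | b :: l => b.toNat + 2 * binVal l

theorem binVal_encodeNat (n : ℕ) : binVal (Computability.encodeNat n) = n := by
  have h : ∀ p : PosNum, binVal (Computability.encodePosNum p) = p := by
    intro p
    induction p with
    | one => rfl
    | bit0 p ih =>
      rw [Computability.encodePosNum, binVal, ih, PosNum.cast_bit0]
      simp [two_mul]
    | bit1 p ih =>
      rw [Computability.encodePosNum, binVal, ih, PosNum.cast_bit1]
      simp only [Bool.toNat_true]
      omega
  unfold Computability.encodeNat Computability.encodeNum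
  conv_rhs => rw [← Num.to_of_nat n]
  cases (n : Num) with
  | zero => rfl
  | pos p => exact h p

theorem size_bits (l : List Bool) : size l = 6 * l.length + 1 := by
  induction l with
  | nil => rfl
  | cons b l ih => rw [size_cons, size_bool, ih, List.length_cons]; omega

/-- The state of `zipPad` after a digit: what remains of the two numbers, and the pairs so far. -/
def zipStep (s : (List Bool × List Bool) × List (Bool × Bool)) :
    (List Bool × List Bool) × List (Bool × Bool) :=
  ((s.1.1.tail, s.1.2.tail), (s.1.1.headD false, s.1.2.headD false) :: s.2)

/-- The pairs of corresponding digits of two numbers, both padded with zeros to a length that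
suffices for either. -/
def zipPad (u v : List Bool) : List (Bool × Bool) :=
  ((u ++ v).foldl (fun s _ => zipStep s) ((u, v), [])).2.reverse

theorem zipStep_foldl (w : List Bool) : ∀ (u v : List Bool) (o : List (Bool × Bool)),
    u.length ≤ w.length → v.length ≤ w.length → ∃ z : List (Bool × Bool),
      (w.foldl (fun s _ => zipStep s) ((u, v), o)).2 = z.reverse ++ o ∧ z.length = w.length ∧
        binVal (z.map Prod.fst) = binVal u ∧ binVal (z.map Prod.snd) = binVal v := by
  induction w with
  | nil =>
    intro u v o hu hv
    obtain rfl := List.length_eq_zero_iff.1 (Nat.le_zero.1 hu)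
    obtain rfl := List.length_eq_zero_iff.1 (Nat.le_zero.1 hv)
    exact ⟨[], rfl, rfl, rfl, rfl⟩
  | cons c w ih =>
    intro u v o hu hv
    obtain ⟨z, h₁, h₂, h₃, h₄⟩ := ih u.tail v.tail ((u.headD false, v.headD false) :: o)
      (by simpa [Nat.sub_le_iff_le_add] using hu) (by simpa [Nat.sub_le_iff_le_add] using hv)
    have h₅ : ∀ u : List Bool, binVal (u.headD false :: u.tail) = binVal u := by
      rintro (_ | ⟨b, u⟩) <;> rfl
    refine ⟨(u.headD false, v.headD false) :: z, ?_, by simp [h₂], ?_, ?_⟩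
    · rw [List.foldl_cons, List.reverse_cons, List.append_assoc]
      exact h₁
    · rw [List.map_cons, binVal, h₃]
      exact h₅ u
    · rw [List.map_cons, binVal, h₄]
      exact h₅ v

theorem zipPad_spec (u v : List Bool) : (zipPad u v).length = u.length + v.length ∧
    binVal ((zipPad u v).map Prod.fst) = binVal u ∧
      binVal ((zipPad u v).map Prod.snd) = binVal v := by
  obtain ⟨z, h₁, h₂, h₃, h₄⟩ := zipStep_foldl (u ++ v) u v [] (by simp) (by simp)
  rw [zipPad, h₁, List.append_nil, List.reverse_reverse]
  exact ⟨by simpa using h₂, h₃, h₄⟩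

/-- The comparison `u ≤ v` of two numbers, from the least significant digit on. -/
def leBits (u v : List Bool) : Bool :=
  (zipPad u v).foldl (fun r p => bif p.1 == p.2 then r else p.2) true

theorem leBits_iff (u v : List Bool) : leBits u v = true ↔ binVal u ≤ binVal v := by
  have h : ∀ (z : List (Bool × Bool)) (r : Bool),
      z.foldl (fun r p => bif p.1 == p.2 then r else p.2) r = true ↔
        binVal (z.map Prod.fst) < binVal (z.map Prod.snd) ∨
          binVal (z.map Prod.fst) = binVal (z.map Prod.snd) ∧ r = true := by
    intro z
    induction z with
    | nil => intro r; simp [binVal]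
    | cons p z ih =>
      intro r
      obtain ⟨x, y⟩ := p
      rw [List.foldl_cons, ih]
      cases x <;> cases y <;> simp [binVal] <;> omega
  rw [leBits, h, (zipPad_spec u v).2.1, (zipPad_spec u v).2.2]
  simp [le_iff_lt_or_eq]

/-- One step of binary addition: the carry, and the digits so far in reverse order. -/
def addStep (s : Bool × List Bool) (p : Bool × Bool) : Bool × List Bool :=
  ((p.1 && p.2) || (s.1 && (p.1 || p.2)), (s.1 == (p.1 == p.2)) :: s.2)

/-- Binary addition. -/
def addBits (u v : List Bool) : List Bool :=
  let s := (zipPad u v).foldl addStep (false, [])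
  (s.1 :: s.2).reverse

theorem addBits_spec (u v : List Bool) : (addBits u v).length = u.length + v.length + 1 ∧
    binVal (addBits u v) = binVal u + binVal v := by
  have h : ∀ (z : List (Bool × Bool)) (c : Bool) (o : List Bool), ∃ w : List Bool,
      ((z.foldl addStep (c, o)).1 :: (z.foldl addStep (c, o)).2).reverse = o.reverse ++ w ∧
        w.length = z.length + 1 ∧
        binVal w = binVal (z.map Prod.fst) + binVal (z.map Prod.snd) + c.toNat := by
    intro z
    induction z with
    | nil => intro c o; exact ⟨[c], by simp, rfl, by simp [binVal]⟩
    | cons p z ih =>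
      intro c o
      obtain ⟨x, y⟩ := p
      obtain ⟨w, h₁, h₂, h₃⟩ := ih ((x && y) || (c && (x || y))) ((c == (x == y)) :: o)
      refine ⟨(c == (x == y)) :: w, ?_, by simp [h₂], ?_⟩
      · rw [List.foldl_cons]
        simpa [addStep] using h₁
      · rw [binVal, h₃]
        cases x <;> cases y <;> cases c <;> simp [binVal] <;> omega
  obtain ⟨w, h₁, h₂, h₃⟩ := h (zipPad u v) false []
  have h₄ : addBits u v = w := h₁
  rw [h₄, h₂, h₃, (zipPad_spec u v).1, (zipPad_spec u v).2.1, (zipPad_spec u v).2.2]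
  simp

/-- Binary multiplication. -/
def mulBits (u v : List Bool) : List Bool :=
  u.reverse.foldl (fun s b => addBits (bif b then v else []) (false :: s)) []

theorem binVal_mulBits (u v : List Bool) : binVal (mulBits u v) = binVal u * binVal v := by
  rw [mulBits, List.foldl_reverse]
  induction u with
  | nil => simp [binVal]
  | cons b u ih =>
    rw [List.foldr_cons, (addBits_spec _ _).2, binVal, ih, binVal]
    cases b
    · simp [binVal]; ring
    · simp; ring

namespace PolyTime

@[fun_prop]
theorem zipPad {f g : α → List Bool} (hf : PolyTime f) (hg : PolyTime g) :
    PolyTime fun a => zipPad (f a) (g a) := by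
  have h := foldl_of_size_le (l := fun p : List Bool × List Bool => p.1 ++ p.2)
    (s := fun p => (p, ([] : List (Bool × Bool)))) (f := fun _ s _ => zipStep s) (by fun_prop)
    (by fun_prop) (by unfold zipStep; fun_prop) 12 fun a s b => by
      have h₁ := size_tail_le s.1.1
      have h₂ := size_tail_le s.1.2
      simp only [zipStep, size_prod, size_cons, size_bool, Polynomial.eval_ofNat]
      omega
  exact (h.snd.reverse.comp (g := fun a => (f a, g a)) (by fun_prop))

@[fun_prop]
theorem leBits {f g : α → List Bool} (hf : PolyTime f) (hg : PolyTime g) :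
    PolyTime fun a => leBits (f a) (g a) := by
  have h := foldl_of_size_le (s := fun _ => true)
    (f := fun _ r (p : Bool × Bool) => bif p.1 == p.2 then r else p.2) (hf.zipPad hg)
    (by fun_prop) (by fun_prop) 0 fun a s b => by simp [size_bool]
  exact h

@[fun_prop]
theorem addBits {f g : α → List Bool} (hf : PolyTime f) (hg : PolyTime g) :
    PolyTime fun a => addBits (f a) (g a) := by
  have h := foldl_of_size_le (s := fun _ => (false, ([] : List Bool)))
    (f := fun _ s p => addStep s p) (hf.zipPad hg)
    (by fun_prop) (by unfold addStep; fun_prop) 6 fun a s b => by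
      simp only [addStep, size_prod, size_cons, size_bool, Polynomial.eval_ofNat]
      omega
  exact (h.fst.cons h.snd).reverse

@[fun_prop]
theorem mulBits {f g : α → List Bool} (hf : PolyTime f) (hg : PolyTime g) :
    PolyTime fun a => mulBits (f a) (g a) := by
  obtain ⟨q, hq⟩ := hf.exists_size_le
  obtain ⟨q', hq'⟩ := hg.exists_size_le
  refine foldl (f := fun p => StackProg.addBits (bif p.2.2 then g p.1 else []) (false :: p.2.1))
    (s := fun _ => []) hf.reverse (by fun_prop) (by fun_prop) (6 * (q * (q' + 2)) + 1)
    fun a l' hl' => ?_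
  have h : ∀ l' : List Bool, (l'.foldl (fun s b => StackProg.addBits (bif b then g a else [])
      (false :: s)) []).length ≤ l'.length * ((g a).length + 2) := by
    intro l'
    induction l' using List.reverseRecOn with
    | nil => simp
    | append_singleton l b ih =>
      rw [List.foldl_append, List.foldl_cons, List.foldl_nil, (addBits_spec _ _).1,
        List.length_append, List.length_singleton, Nat.succ_mul, List.length_cons]
      have : (bif b then g a else []).length ≤ (g a).length := by cases b <;> simp
      omega
  rw [size_bits]
  simp only [Polynomial.eval_add, Polynomial.eval_mul, Polynomial.eval_ofNat, Polynomial.eval_one]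
  have h₁ : l'.length ≤ q.eval (size a) := by
    have h₂ := length_lt_size (f a)
    have h₃ := hl'.length_le
    have h₄ := hq a
    rw [List.length_reverse] at h₃
    omega
  have h₂ : (g a).length ≤ q'.eval (size a) := (length_lt_size _).le.trans (hq' a)
  exact Nat.succ_le_succ (Nat.mul_le_mul_left _
    ((h l').trans (Nat.mul_le_mul h₁ (Nat.add_le_add_right h₂ 2))))

end PolyTime

/-- A payoff as it is read off the input: the sign bit and the digits of the numerator, and the
digits of the denominator. -/
abbrev Entry : Type := List Bool × List Bool

/-- The payoff that is read off the encoding of a rational number. -/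
def entryOf (q : ℚ) : Entry :=
  (decide (q < 0) :: Computability.encodeNat q.num.natAbs, Computability.encodeNat q.den)

/-- The comparison of two payoffs, by cross-multiplication. -/
def leEntry (x y : Entry) : Bool :=
  bif x.1.headD false then
    bif y.1.headD false then leBits (mulBits y.1.tail x.2) (mulBits x.1.tail y.2) else true
  else
    bif y.1.headD false then false else leBits (mulBits x.1.tail y.2) (mulBits y.1.tail x.2)

theorem leEntry_entryOf (p q : ℚ) : leEntry (entryOf p) (entryOf q) = decide (p ≤ q) := by
  have h₁ : ∀ q : ℚ, q < 0 → (q.num.natAbs : ℤ) = -q.num := fun q hq => by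
    have := Rat.num_neg.2 hq; omega
  have h₂ : ∀ q : ℚ, ¬ q < 0 → (q.num.natAbs : ℤ) = q.num := fun q hq => by
    have := mt Rat.num_neg.1 hq; omega
  have h₃ : p ≤ q ↔ p.num * q.den ≤ q.num * p.den := Rat.le_iff ..
  by_cases hp : p < 0 <;> by_cases hq : q < 0
  · rw [Bool.eq_iff_iff]
    simp only [leEntry, entryOf, hp, hq, decide_true, List.headD_cons, cond_true, List.tail_cons,
      leBits_iff, binVal_mulBits, binVal_encodeNat, decide_eq_true_eq, h₃]
    rw [← Int.ofNat_le]
    push_cast [-Int.natCast_natAbs]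
    rw [h₁ p hp, h₁ q hq]
    constructor <;> intro h <;> linarith
  · have : p ≤ q := by linarith
    simp [leEntry, entryOf, hp, hq, this]
  · have : ¬ p ≤ q := by linarith
    simp [leEntry, entryOf, hp, hq, this]
  · rw [Bool.eq_iff_iff]
    simp only [leEntry, entryOf, hp, hq, decide_false, List.headD_cons, cond_false, List.tail_cons,
      leBits_iff, binVal_mulBits, binVal_encodeNat, decide_eq_true_eq, h₃]
    rw [← Int.ofNat_le]
    push_cast [-Int.natCast_natAbs]
    rw [h₂ p hp, h₂ q hq]

@[fun_prop]
theorem PolyTime.leEntry {f g : α → Entry} (hf : PolyTime f) (hg : PolyTime g) :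
    PolyTime fun a => leEntry (f a) (g a) := by
  unfold StackProg.leEntry
  fun_prop

end StackProg

/-! ### Reading the input -/

namespace StackProg

open Enc (enc)

variable {α β : Type} [Enc α] [Enc β]

/-- A symbol of the input alphabet as a triple of bits. -/
def symbolBits : GameSymbol → Bool × Bool × Bool
  | .tally => (false, false, false)
  | .slash => (false, false, true)
  | .endEntry => (false, true, false)
  | .endRow => (false, true, true)
  | .endMatrix => (true, true, false)
  | .bit b => (true, false, b)

instance : Enc GameSymbol := ⟨fun s => enc (symbolBits s)⟩

theorem size_symbol (s : GameSymbol) : size s = 17 := by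
  rcases s with _ | b | _ | _ | _ | _
  · rfl
  · cases b <;> rfl
  all_goals rfl

theorem size_input (w : List GameSymbol) : size w = 18 * w.length + 1 := by
  induction w with
  | nil => rfl
  | cons s w ih => rw [size_cons, size_symbol, ih, List.length_cons]; omega

/-- Case distinction on a symbol is a polynomial-time operation. -/
theorem PolyTime.symbolCases {s : α → GameSymbol} {f₁ f₃ f₄ f₅ f₆ : α → β} {f₂ : α → Bool → β}
    (hs : PolyTime s) (h₁ : PolyTime f₁) (h₂ : PolyTime fun p : α × Bool => f₂ p.1 p.2)
    (h₃ : PolyTime f₃) (h₄ : PolyTime f₄) (h₅ : PolyTime f₅) (h₆ : PolyTime f₆) :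
    PolyTime fun a => match s a with
      | .tally => f₁ a
      | .bit b => f₂ a b
      | .slash => f₃ a
      | .endEntry => f₄ a
      | .endRow => f₅ a
      | .endMatrix => f₆ a := by
  have hb : PolyTime fun a => symbolBits (s a) := (of_enc (f := symbolBits) fun _ => rfl).comp hs
  have h₂' : PolyTime fun a => f₂ a (symbolBits (s a)).2.2 :=
    h₂.comp (g := fun a => (a, (symbolBits (s a)).2.2)) (by fun_prop)
  have h : PolyTime fun a =>
      bif (symbolBits (s a)).1 then
        bif (symbolBits (s a)).2.1 then f₆ a else f₂ a (symbolBits (s a)).2.2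
      else bif (symbolBits (s a)).2.1 then bif (symbolBits (s a)).2.2 then f₅ a else f₄ a
      else bif (symbolBits (s a)).2.2 then f₃ a else f₁ a := by
    fun_prop
  refine cast (congrArg PolyTime (funext fun a => ?_)) h
  cases s a <;> rfl

/-- The state of the parser: the number of tally marks, the digits of the numerator, the digits of
the field that is being read, the entries of the row that is being read, the rows of the matrix
that is being read, and the matrices that have been read, each list in reverse order. -/
abbrev ParseState : Type :=
  ℕ × List Bool × List Bool × List Entry × List (List Entry) × List (List (List Entry))

/-- What the parser does with a symbol. -/
def parseStep (s : ParseState) : GameSymbol → ParseState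
  | .tally => (s.1 + 1, s.2)
  | .bit b => (s.1, s.2.1, b :: s.2.2.1, s.2.2.2)
  | .slash => (s.1, s.2.2.1.reverse, [], s.2.2.2)
  | .endEntry => (s.1, [], [], (s.2.1, s.2.2.1.reverse) :: s.2.2.2.1, s.2.2.2.2)
  | .endRow => (s.1, s.2.1, s.2.2.1, [], s.2.2.2.1.reverse :: s.2.2.2.2.1, s.2.2.2.2.2)
  | .endMatrix =>
    (s.1, s.2.1, s.2.2.1, s.2.2.2.1, [], s.2.2.2.2.1.reverse :: s.2.2.2.2.2)

/-- The strategy and the first matrix of an instance. -/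
def parse (w : List GameSymbol) : ℕ × List (List Entry) :=
  let s := w.foldl parseStep (0, [], [], [], [], [])
  (s.1, s.2.2.2.2.2.tail.headD [])

theorem PolyTime.parse : PolyTime parse := by
  have h : PolyTime fun p : List GameSymbol × (ParseState × GameSymbol) =>
      parseStep p.2.1 p.2.2 := by
    refine PolyTime.symbolCases (s := fun p : List GameSymbol × (ParseState × GameSymbol) => p.2.2)
      (f₂ := fun p b => (p.2.1.1, p.2.1.2.1, b :: p.2.1.2.2.1, p.2.1.2.2.2))
      ?_ ?_ ?_ ?_ ?_ ?_ ?_ <;> fun_prop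
  have h' := foldl_of_size_le (l := fun w : List GameSymbol => w)
    (s := fun _ => ((0, [], [], [], [], []) : ParseState)) (f := fun _ s b => parseStep s b)
    (by fun_prop) (by fun_prop) h 9 fun a s b => by
      obtain ⟨t, u, v, r, m, l⟩ := s
      rw [Polynomial.eval_ofNat]
      rcases b with _ | b | _ | _ | _ | _ <;>
        simp only [parseStep, size_mk, size_cons, size_nil, size_reverse, size_nat, size_bool] <;>
        omega
  unfold StackProg.parse
  fun_prop

/-- The matrix of payoffs that is read off the encoding of a matrix. -/
def rowsOf {n m : ℕ} (M : Matrix (Fin n) (Fin m) ℚ) : List (List Entry) :=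
  (List.finRange n).map fun i => (List.finRange m).map fun j => entryOf (M i j)

theorem parse_bits (t : ℕ) (u v : List Bool) (R : List Entry × _ × _) (l : List Bool) :
    (l.map GameSymbol.bit).foldl parseStep (t, u, v, R) = (t, u, l.reverse ++ v, R) := by
  induction l generalizing v with
  | nil => rfl
  | cons b l ih =>
    rw [List.map_cons, List.foldl_cons, parseStep, ih]
    simp

theorem parse_entry (t : ℕ) (r : List Entry) (R : _ × _) (q : ℚ) :
    (encodeRat q ++ [GameSymbol.endEntry]).foldl parseStep (t, [], [], r, R) =
      (t, [], [], entryOf q :: r, R) := by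
  simp [encodeRat, parse_bits, parseStep, entryOf]

theorem parse_row {m : ℕ} (t : ℕ) (M : List (List Entry)) (R : _) (v : Fin m → ℚ) :
    (encodeRow v).foldl parseStep (t, [], [], [], M, R) =
      (t, [], [], [], ((List.finRange m).map fun j => entryOf (v j)) :: M, R) := by
  have h : ∀ (l : List (Fin m)) (r : List Entry),
      (l.flatMap fun j => encodeRat (v j) ++ [GameSymbol.endEntry]).foldl parseStep
        (t, [], [], r, M, R) = (t, [], [], (l.map fun j => entryOf (v j)).reverse ++ r, M, R) := by
    intro l
    induction l with
    | nil => intro r; rfl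
    | cons j l ih =>
      intro r
      rw [List.flatMap_cons, List.foldl_append, parse_entry, ih]
      simp
  rw [encodeRow, List.foldl_append, h]
  simp [parseStep]

theorem parse_matrix {n m : ℕ} (t : ℕ) (R : List (List (List Entry)))
    (M : Matrix (Fin n) (Fin m) ℚ) :
    (encodeMatrix M).foldl parseStep (t, [], [], [], [], R) =
      (t, [], [], [], [], rowsOf M :: R) := by
  have h : ∀ (l : List (Fin n)) (N : List (List Entry)),
      (l.flatMap fun i => encodeRow (M i)).foldl parseStep (t, [], [], [], N, R) =
        (t, [], [], [],
          (l.map fun i => (List.finRange m).map fun j => entryOf (M i j)).reverse ++ N, R) := by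
    intro l
    induction l with
    | nil => intro r; rfl
    | cons j l ih =>
      intro r
      rw [List.flatMap_cons, List.foldl_append, parse_row, ih]
      simp
  rw [encodeMatrix, List.foldl_append, h]
  simp [parseStep, rowsOf]

theorem parse_encode (x : ZDominanceInstance) :
    parse (encodeZDominanceInstance x) = ((x.strategy : ℕ), rowsOf x.game.A) := by
  have h : ∀ (k t : ℕ) R, (List.replicate k GameSymbol.tally).foldl parseStep (t, R) =
      (t + k, R) := by
    intro k
    induction k with
    | zero => intro t R; rfl
    | succ k ih =>
      intro t R
      rw [List.replicate_succ, List.foldl_cons, parseStep, ih, Nat.add_assoc, Nat.add_comm 1]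
  unfold parse
  rw [encodeZDominanceInstance, List.foldl_append, List.foldl_append, h, parse_matrix,
    parse_matrix]
  simp

/-! ### From polynomial-time functions to machines -/

/-- The word that a symbol in the register contributes to the representation of the input. -/
def registerWord : Register GameSymbol → List Bool
  | some (Sum.inr s) => true :: (enc s).code
  | _ => []

/-- Pushes the given bits onto the stack `a`, and reads the next symbol of the input. -/
def pushThenRead : List (Register GameSymbol → Bool) → Prog GameSymbol
  | [] => .pop none
  | f :: l => .seq (.push .a f) (pushThenRead l)

theorem runs_pushThenRead (v : Register GameSymbol) (i : List GameSymbol)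
    (l : List (Register GameSymbol → Bool)) : ∀ (m a : List Bool),
      Runs (pushThenRead l) ⟨v, i, stk m a⟩
        ⟨i.head?.map Sum.inr, i.tail, stk m ((l.map fun f => f v).reverse ++ a)⟩
        (l.length + 1) := by
  induction l with
  | nil => exact fun m a => ⟨1, le_rfl, .popInput ..⟩
  | cons f l ih =>
    intro m a
    have h := Runs.push .a f v i (stk m a)
    rw [update_stk_a] at h
    have h' := h.seq (ih m (f v :: a))
    simp only [List.map_cons, List.reverse_cons, List.append_assoc, List.singleton_append]
    exact h'.mono (by simp only [List.length_cons]; omega)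

/-- Pushes the representation of the symbol in the register onto the stack `a`, and reads the next
symbol. All symbols are represented by words of the same length. -/
def loadSymbol : Prog GameSymbol :=
  pushThenRead ((List.range 18).map fun i v => (registerWord v).getD i false)

theorem runs_loadSymbol (s : GameSymbol) (i : List GameSymbol) (m a : List Bool) :
    Runs loadSymbol ⟨some (Sum.inr s), i, stk m a⟩
      ⟨i.head?.map Sum.inr, i.tail, stk m ((true :: (enc s).code).reverse ++ a)⟩ 19 := by
  have h := runs_pushThenRead (some (Sum.inr s)) i
    ((List.range 18).map fun i v => (registerWord v).getD i false) m a
  have h₁ : ((List.range 18).map fun i (v : Register GameSymbol) =>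
      (registerWord v).getD i false).map (fun f => f (some (Sum.inr s))) =
        true :: (enc s).code := by
    rcases s with _ | b | _ | _ | _ | _
    · rfl
    · cases b <;> rfl
    all_goals rfl
  rw [h₁] at h
  exact h

/-- Moves the input to the main stack. -/
def load : Prog GameSymbol :=
  .seq (.pop none) (.seq (.loop Option.isSome loadSymbol)
    (.seq (pushBit .a false) (pour .a .main)))

theorem runs_load (w : List GameSymbol) :
    Runs load ⟨none, w, stk []⟩ ⟨none, [], stk (enc w).code⟩ (80 * w.length + 20) := by
  have H : ∀ (w : List GameSymbol) (a : List Bool), ∃ a',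
      Runs (.loop Option.isSome loadSymbol) ⟨w.head?.map Sum.inr, w.tail, stk [] a⟩
        ⟨none, [], stk [] a'⟩ (20 * w.length + 1) ∧
        (false :: a').reverse = a.reverse ++ (enc w).code := by
    intro w
    induction w with
    | nil => exact fun a => ⟨a, Runs.loopFalse rfl, by simp [enc, encList, BinTree.code]⟩
    | cons s w ih =>
      intro a
      obtain ⟨a', h₁, h₂⟩ := ih ((true :: (enc s).code).reverse ++ a)
      refine ⟨a', (Runs.loopTrue rfl (runs_loadSymbol s w [] a) h₁).mono
        (by simp only [List.length_cons]; omega), ?_⟩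
      rw [h₂]
      simp [enc, encList, BinTree.code]
  obtain ⟨a, h₁, h₂⟩ := H w []
  have h₃ := Runs.push .a (fun _ => false) none ([] : List GameSymbol) (stk [] a)
  rw [update_stk_a] at h₃
  have h₄ := runs_pour_a (Γ := GameSymbol) none [] [] (false :: a) [] []
  rw [h₂] at h₄
  have h₅ : (false :: a).length = size w := by
    rw [← List.length_reverse, h₂]
    simp [size]
  rw [h₅, size_input] at h₄
  have h₀ : Runs (.pop none) ⟨none, w, stk []⟩ ⟨w.head?.map Sum.inr, w.tail, stk []⟩ 1 :=
    ⟨1, le_rfl, .popInput ..⟩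
  have := h₀.seq (h₁.seq (h₃.seq h₄))
  simp only [List.reverse_nil, List.nil_append, List.append_nil] at this
  exact this.mono (by omega)

/-- Moves the answer from the main stack to the output stack, and empties the register. -/
def unload : Prog GameSymbol :=
  .seq (.pop (some .main)) (.seq (.pop (some .main)) (.seq (pushReg .out)
    (.seq (.pop (some .main)) (.seq (.pop (some .main)) (.seq (.pop (some .main))
      (.pop (some .main)))))))

theorem runs_unload (v : Register GameSymbol) (b : Bool) :
    Runs unload ⟨v, [], stk (enc b).code⟩ ⟨none, [], Function.update (fun _ => []) .out [b]⟩ 7 := by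
  have h := (Runs.pop .main v ([] : List GameSymbol) (stk (enc b).code)).seq
    ((Runs.pop .main _ _ _).seq
    ((Runs.push .out isTrue _ _ _).seq ((Runs.pop .main _ _ _).seq ((Runs.pop .main _ _ _).seq
    ((Runs.pop .main _ _ _).seq (Runs.pop .main _ _ _))))))
  convert h using 2
  · cases b <;> rfl
  · cases b <;> rfl
  · funext k
    cases b <;> cases k <;> rfl

/-- A problem whose instances are answered by a polynomial-time function of their encodings is
decidable in polynomial time. -/
theorem decidableInPolyTime_of_polyTime {ι : Type} (e : ι → List GameSymbol) (problem : ι → Prop)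
    {f : List GameSymbol → Bool} (hf : PolyTime f) (h : ∀ x, f (e x) = true ↔ problem x) :
    DecidableInPolyTime e problem := by
  obtain ⟨p, q, hp⟩ := hf GameSymbol
  refine decidableInPolyTime_of_exec e problem (fun x => f (e x)) h (.seq load (.seq p unload))
    (80 * .X + 27 + q.comp (18 * .X + 1)) fun x => ?_
  obtain ⟨v, h₁⟩ := (hp (e x)).1 [] none []
  rw [List.append_nil, List.append_nil, size_input] at h₁
  have h₃ := (runs_load (e x)).seq (h₁.seq (runs_unload v _))
  have h₄ : stk [] = fun _ => [] := by funext k; cases k <;> rfl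
  rw [h₄] at h₃
  obtain ⟨n, hn, h₅⟩ := h₃
  refine ⟨n, ?_, h₅⟩
  simp only [Polynomial.eval_add, Polynomial.eval_X, Polynomial.eval_ofNat, Polynomial.eval_mul,
    Polynomial.eval_comp, Polynomial.eval_one]
  omega

end StackProg

/-! ### Iterated dominance in constant-sum games -/

namespace SymmetricElimination

open Relation

/-- The strategies of both players of a constant-sum game, with `U x w` the payoff that strategy `x`
yields to its owner against strategy `w` of the opponent. Treating the players alike, `U` is
antisymmetric, and it vanishes between strategies of the same player. -/
structure Game (V : Type*) where
  side : V → Bool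
  U : V → V → ℚ
  antisymm : ∀ x y, U y x = -U x y
  zero : ∀ x y, side x = side y → U x y = 0

variable {V : Type*} (G : Game V)

namespace Game

/-- `x` is at least as good as `y` against the strategies in `S`. -/
def Dom (S : Finset V) (x y : V) : Prop :=
  G.side x = G.side y ∧ ∀ w ∈ S, G.U y w ≤ G.U x w

variable {G}

theorem Dom.mono {S T : Finset V} {x y : V} (h : G.Dom S x y) (hT : T ⊆ S) : G.Dom T x y :=
  ⟨h.1, fun w hw => h.2 w (hT hw)⟩

theorem Dom.trans {S : Finset V} {x y z : V} (h : G.Dom S x y) (h' : G.Dom S y z) : G.Dom S x z :=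
  ⟨h.1.trans h'.1, fun w hw => (h'.2 w hw).trans (h.2 w hw)⟩

/-- If every strategy in `T` has a duplicate in `S`, then a comparison of strategies in `S` that
holds on `S` holds on `T`. -/
theorem Dom.of_cover {S T : Finset V} (hST : S ⊆ T)
    (hcover : ∀ y ∈ T, ∃ x ∈ S, G.Dom T x y ∧ G.Dom T y x) {x y : V} (hx : x ∈ S) (hy : y ∈ S)
    (h : G.Dom S x y) : G.Dom T x y := by
  refine ⟨h.1, fun w hw => ?_⟩
  obtain ⟨u, hu, h₁, h₂⟩ := hcover w hw
  have e : ∀ z ∈ S, G.U z w = G.U z u := fun z hz => by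
    rw [G.antisymm w z, G.antisymm u z,
      le_antisymm (h₁.2 z (hST hz)) (h₂.2 z (hST hz))]
  rw [e x hx, e y hy]
  exact h.2 u hu

variable [DecidableEq V]

variable (G) in
/-- Elimination of a dominated strategy. -/
def StrictStep (S S' : Finset V) : Prop :=
  ∃ x y, x ∈ S ∧ G.Dom S x y ∧ (∃ w ∈ S, G.U y w < G.U x w) ∧ S' = S.erase y

variable (G) in
/-- Elimination of a strategy outside `P` for which another strategy is at least as good. -/
def WeakStep (P : Set V) (S S' : Finset V) : Prop :=
  ∃ x y, x ∈ S ∧ y ∈ S ∧ y ∉ P ∧ x ≠ y ∧ G.Dom S x y ∧ S' = S.erase y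

theorem reflTransGen_strictStep_sdiff {S Z : Finset V} {x w : V} (hx : x ∈ S) (hxZ : x ∉ Z)
    (hw : w ∈ S) (hwZ : w ∉ Z) (h : ∀ z ∈ Z, G.Dom S x z ∧ G.U z w < G.U x w) :
    ReflTransGen G.StrictStep S (S \ Z) := by
  induction Z using Finset.induction_on with
  | empty => rw [Finset.sdiff_empty]
  | insert z Z hz ih =>
    simp only [Finset.mem_insert, not_or] at hxZ hwZ
    refine (ih hxZ.2 hwZ.2 fun z' hz' => h z' (Finset.mem_insert_of_mem hz')).tail
      ⟨x, z, Finset.mem_sdiff.2 ⟨hx, hxZ.2⟩, (h z (Finset.mem_insert_self ..)).1.mono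
        Finset.sdiff_subset, ⟨w, Finset.mem_sdiff.2 ⟨hw, hwZ.2⟩,
          (h z (Finset.mem_insert_self ..)).2⟩, ?_⟩
    rw [Finset.sdiff_insert]

/-- Weak elimination can be imitated by proper elimination, except that duplicates of remaining
strategies cannot be removed. -/
theorem exists_strict_of_weak {P : Set V} {S₀ S : Finset V}
    (h : ReflTransGen (G.WeakStep P) S₀ S) :
    ∃ T, ReflTransGen G.StrictStep S₀ T ∧ S ⊆ T ∧
      ∀ y ∈ T, ∃ x ∈ S, G.Dom T x y ∧ G.Dom T y x := by
  induction h with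
  | refl =>
    exact ⟨S₀, .refl, subset_rfl, fun y hy => ⟨y, hy, ⟨rfl, fun _ _ => le_rfl⟩,
      ⟨rfl, fun _ _ => le_rfl⟩⟩⟩
  | @tail S S' _ hstep ih =>
    obtain ⟨T, hT, hST, hcover⟩ := ih
    obtain ⟨x, y, hx, hy, -, hxy, hdom, rfl⟩ := hstep
    have hdom' : G.Dom T x y := hdom.of_cover hST hcover hx hy
    by_cases heq : G.Dom T y x
    · refine ⟨T, hT, (Finset.erase_subset ..).trans hST, fun z hz => ?_⟩
      obtain ⟨u, hu, h₁, h₂⟩ := hcover z hz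
      by_cases huy : u = y
      · subst huy
        exact ⟨x, Finset.mem_erase.2 ⟨hxy, hx⟩, hdom'.trans h₁, h₂.trans heq⟩
      · exact ⟨u, Finset.mem_erase.2 ⟨huy, hu⟩, h₁, h₂⟩
    · -- `x` is strictly better than `y` against some `w`: remove `y` and its duplicates outside `S`
      obtain ⟨w, hw, hlt⟩ : ∃ w ∈ T, G.U y w < G.U x w := by
        by_contra! hcon
        exact heq ⟨hdom'.1.symm, hcon⟩
      classical
      let Z := T.filter fun z => (G.Dom T y z ∧ G.Dom T z y) ∧ z ∉ S.erase y
      have hZ : ∀ z, z ∈ Z ↔ z ∈ T ∧ (G.Dom T y z ∧ G.Dom T z y) ∧ z ∉ S.erase y := fun z =>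
        Finset.mem_filter
      have hsub : S.erase y ⊆ T \ Z := fun z hz =>
        Finset.mem_sdiff.2 ⟨hST (Finset.mem_of_mem_erase hz), fun h => ((hZ z).1 h).2.2 hz⟩
      refine ⟨T \ Z, hT.trans (reflTransGen_strictStep_sdiff (x := x) (w := w) (hST hx) ?_ hw ?_ ?_),
        hsub, ?_⟩
      · exact fun h => heq ((hZ x).1 h).2.1.1
      · intro h
        have h₁ := ((hZ w).1 h).2.1.1.1
        rw [G.zero y w h₁, G.zero x w (hdom'.1.trans h₁)] at hlt
        exact lt_irrefl _ hlt
      · intro z hz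
        obtain ⟨-, h₁, -⟩ := (hZ z).1 hz
        exact ⟨hdom'.trans h₁.1, (h₁.1.2 w hw).trans_lt hlt⟩
      · intro z hz
        obtain ⟨hzT, hzZ⟩ := Finset.mem_sdiff.1 hz
        obtain ⟨u, hu, h₁, h₂⟩ := hcover z hzT
        by_cases huy : u = y
        · subst huy
          have hz' : z ∈ S.erase u := by
            by_contra hcon
            exact hzZ ((hZ z).2 ⟨hzT, ⟨h₁, h₂⟩, hcon⟩)
          exact ⟨z, hz', ⟨rfl, fun _ _ => le_rfl⟩, ⟨rfl, fun _ _ => le_rfl⟩⟩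
        · exact ⟨u, Finset.mem_erase.2 ⟨huy, hu⟩, h₁.mono Finset.sdiff_subset,
            h₂.mono Finset.sdiff_subset⟩

theorem WeakStep.subset {P : Set V} {S S' : Finset V} (h : G.WeakStep P S S') : S' ⊆ S := by
  obtain ⟨x, y, -, -, -, -, -, rfl⟩ := h
  exact Finset.erase_subset ..

/-- Exchanging two duplicates outside `P` is compatible with weak elimination. -/
theorem WeakStep.image_swap {P : Set V} {S : Finset V} {x y : V} (hx : x ∈ S) (hy : y ∈ S)
    (hxP : x ∉ P) (hyP : y ∉ P) (hxy : G.Dom S x y) (hyx : G.Dom S y x) :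
    (∀ T T', T ⊆ S → G.WeakStep P T T' →
      G.WeakStep P (T.image (Equiv.swap x y)) (T'.image (Equiv.swap x y))) ∧
    ∀ T r k, T ⊆ S → r ∈ S → k ∈ S → r ∈ P → k ∈ P → G.Dom T r k →
      G.Dom (T.image (Equiv.swap x y)) r k := by
  set σ := Equiv.swap x y with hσ
  have hU : ∀ a, ∀ b ∈ S, G.U (σ a) b = G.U a b := by
    intro a b hb
    by_cases hax : a = x
    · subst hax
      rw [hσ, Equiv.swap_apply_left]
      exact le_antisymm (hxy.2 b hb) (hyx.2 b hb)
    by_cases hay : a = y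
    · subst hay
      rw [hσ, Equiv.swap_apply_right]
      exact le_antisymm (hyx.2 b hb) (hxy.2 b hb)
    rw [hσ, Equiv.swap_apply_of_ne_of_ne hax hay]
  have hS : ∀ a ∈ S, σ a ∈ S := by
    intro a ha
    rw [hσ, Equiv.swap_apply_def]
    split_ifs <;> assumption
  have hside : ∀ a, G.side (σ a) = G.side a := by
    intro a
    rw [hσ, Equiv.swap_apply_def]
    split_ifs with h₁ h₂
    · rw [h₁]; exact hyx.1
    · rw [h₂]; exact hxy.1
    · rfl
  have hP : ∀ a, a ∈ P → σ a = a := fun a ha =>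
    Equiv.swap_apply_of_ne_of_ne (fun h => hxP (h ▸ ha)) (fun h => hyP (h ▸ ha))
  have hUU : ∀ a ∈ S, ∀ b ∈ S, G.U (σ a) (σ b) = G.U a b := by
    intro a ha b hb
    rw [hU a _ (hS b hb), G.antisymm (σ b) a, hU b a ha, ← G.antisymm]
  have hdom : ∀ T a b, T ⊆ S → a ∈ S → b ∈ S → G.Dom T a b →
      G.Dom (T.image σ) (σ a) (σ b) := by
    intro T a b hT ha hb h
    refine ⟨by rw [hside, hside, h.1], fun w hw => ?_⟩
    obtain ⟨u, hu, rfl⟩ := Finset.mem_image.1 hw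
    rw [hUU _ hb _ (hT hu), hUU _ ha _ (hT hu)]
    exact h.2 u hu
  refine ⟨?_, ?_⟩
  · rintro T _ hT ⟨a, b, ha, hb, hbP, hab, h, rfl⟩
    refine ⟨σ a, σ b, Finset.mem_image_of_mem _ ha, Finset.mem_image_of_mem _ hb, fun hcon => ?_,
      σ.injective.ne hab, hdom T a b hT (hT ha) (hT hb) h, Finset.image_erase σ.injective ..⟩
    have h₁ := hP _ hcon
    rw [σ.injective h₁] at hcon
    exact hbP hcon
  · intro T r k hT hr hk hrP hkP h
    have := hdom T r k hT hr hk h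
    rwa [hP r hrP, hP k hkP] at this

variable (G) in
/-- `r` becomes at least as good as `k` after some weak elimination that spares `P`. -/
def Reachable (P : Set V) (r k : V) (S : Finset V) : Prop :=
  ∃ T, ReflTransGen (G.WeakStep P) S T ∧ G.Dom T r k

/-- Weak elimination does no harm: two steps that do not commute remove duplicates. -/
theorem Reachable.of_weakStep {P : Set V} {r k : V} (hrP : r ∈ P) (hkP : k ∈ P)
    {S S' : Finset V} (hPS : P ⊆ S) (h : G.Reachable P r k S) (hS : G.WeakStep P S S') :
    G.Reachable P r k S' := by
  obtain ⟨T, hST, hT⟩ := h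
  induction hST using ReflTransGen.head_induction_on generalizing S' with
  | refl => exact ⟨S', .refl, hT.mono hS.subset⟩
  | @head S S₁ hS₁ h₁ ih =>
    obtain ⟨x, y, hx, hy, hyP, hxy, hdom, rfl⟩ := hS
    obtain ⟨x₁, y₁, hx₁, hy₁, hy₁P, hxy₁, hdom₁, rfl⟩ := hS₁
    by_cases hyy : y = y₁
    · subst hyy
      exact ⟨T, h₁, hT⟩
    by_cases hswap : x = y₁ ∧ x₁ = y
    · obtain ⟨rfl, rfl⟩ := hswap
      obtain ⟨H, H'⟩ := WeakStep.image_swap hy hx hyP hy₁P hdom₁ hdom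
      have himg : (S.erase x).image (Equiv.swap x₁ x) = S.erase x₁ := by
        rw [Finset.image_erase (Equiv.injective _), Equiv.swap_apply_right]
        congr 1
        refine Finset.eq_of_subset_of_card_le (Finset.image_subset_iff.2 fun z hz => ?_)
          (Finset.card_image_of_injective _ (Equiv.injective _)).ge
        rw [Equiv.swap_apply_def]
        split_ifs <;> assumption
      have hT' : ReflTransGen (G.WeakStep P) (S.erase x₁) (T.image (Equiv.swap x₁ x)) ∧ T ⊆ S := by
        rw [← himg]
        clear ih hT
        induction h₁ with
        | refl => exact ⟨.refl, Finset.erase_subset ..⟩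
        | tail _ hstep ih => exact ⟨ih.1.tail (H _ _ ih.2 hstep), hstep.subset.trans ih.2⟩
      exact ⟨_, hT'.1, H' T r k hT'.2 (hPS hrP) (hPS hkP) hrP hkP hT⟩
    · have hPS₁ : P ⊆ (S.erase y₁ : Finset V) := fun p hp =>
        Finset.mem_coe.2 (Finset.mem_erase.2 ⟨fun h => hy₁P (h ▸ hp), hPS hp⟩)
      obtain ⟨U, hU, hU'⟩ := ih hPS₁ (S' := (S.erase y).erase y₁) (by
        by_cases hxy₁' : x = y₁
        · refine ⟨x₁, y, Finset.mem_erase.2 ⟨hxy₁, hx₁⟩, Finset.mem_erase.2 ⟨hyy, hy⟩, hyP,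
            fun h => hswap ⟨hxy₁', h⟩, ?_, Finset.erase_right_comm⟩
          subst hxy₁'
          exact (hdom₁.trans hdom).mono (Finset.erase_subset ..)
        · exact ⟨x, y, Finset.mem_erase.2 ⟨hxy₁', hx⟩, Finset.mem_erase.2 ⟨hyy, hy⟩, hyP, hxy,
            hdom.mono (Finset.erase_subset ..), Finset.erase_right_comm⟩)
      refine ⟨U, .head ?_ hU, hU'⟩
      by_cases hxy₁' : x₁ = y
      · refine ⟨x, y₁, Finset.mem_erase.2 ⟨hxy, hx⟩, Finset.mem_erase.2 ⟨Ne.symm hyy, hy₁⟩, hy₁P,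
          fun h => hswap ⟨h, hxy₁'⟩, ?_, rfl⟩
        subst hxy₁'
        exact (hdom.trans hdom₁).mono (Finset.erase_subset ..)
      · exact ⟨x₁, y₁, Finset.mem_erase.2 ⟨hxy₁', hx₁⟩, Finset.mem_erase.2 ⟨Ne.symm hyy, hy₁⟩, hy₁P,
          hxy₁, hdom₁.mono (Finset.erase_subset ..), rfl⟩

theorem subset_of_reflTransGen {P : Set V} {S T : Finset V} (hPS : P ⊆ S)
    (h : ReflTransGen (G.WeakStep P) S T) : P ⊆ T := by
  induction h with
  | refl => exact hPS
  | tail _ hstep ih =>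
    obtain ⟨x, y, -, -, hy, -, -, rfl⟩ := hstep
    exact fun p hp => Finset.mem_coe.2 (Finset.mem_erase.2 ⟨fun h => hy (h ▸ hp), ih hp⟩)

/-- Once nothing outside `P` can be eliminated weakly, the order of the eliminations has not
mattered. -/
theorem reachable_iff_of_terminal {P : Set V} {r k : V} (hrP : r ∈ P) (hkP : k ∈ P)
    {S₀ S : Finset V} (hPS : P ⊆ S₀) (h : ReflTransGen (G.WeakStep P) S₀ S)
    (hS : ∀ S', ¬ G.WeakStep P S S') : G.Reachable P r k S₀ ↔ G.Dom S r k := by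
  refine ⟨fun h' => ?_, fun h' => ⟨S, h, h'⟩⟩
  have H : G.Reachable P r k S := by
    clear hS
    induction h with
    | refl => exact h'
    | tail h₁ hstep ih =>
      exact ih.of_weakStep hrP hkP (subset_of_reflTransGen hPS h₁) hstep
  obtain ⟨T, hT, hdom⟩ := H
  rcases hT.cases_head with rfl | ⟨S', h₁, -⟩
  · exact hdom
  · exact absurd h₁ (hS S')

/-- A strategy can be eliminated by proper steps if and only if some strategy `r` that is strictly
better against some `c` becomes at least as good as it by weak elimination that spares these
three. -/
theorem exists_strict_iff {S₀ : Finset V} {k : V} (hk : k ∈ S₀) :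
    (∃ T, ReflTransGen G.StrictStep S₀ T ∧ k ∉ T) ↔
      ∃ r ∈ S₀, ∃ c ∈ S₀, G.U k c < G.U r c ∧ G.Reachable {r, k, c} r k S₀ := by
  constructor
  · rintro ⟨T, hT, hkT⟩
    obtain ⟨S, r, c, hS, hrS, hkS, hcS, hdom, hlt⟩ : ∃ S r c, ReflTransGen G.StrictStep S₀ S ∧
        r ∈ S ∧ k ∈ S ∧ c ∈ S ∧ G.Dom S r k ∧ G.U k c < G.U r c := by
      induction hT with
      | refl => exact absurd hk hkT
      | @tail S T hS hstep ih =>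
        by_cases hkS : k ∈ S
        · obtain ⟨x, y, hx, hdom, ⟨w, hw, hlt⟩, rfl⟩ := hstep
          obtain rfl : k = y := by
            by_contra hne
            exact hkT (Finset.mem_erase.2 ⟨hne, hkS⟩)
          exact ⟨S, x, w, hS, hx, hkS, hw, hdom, hlt⟩
        · exact ih hkS
    have H : S ⊆ S₀ ∧ ReflTransGen (G.WeakStep {r, k, c}) S₀ S := by
      have hP : ({r, k, c} : Set V) ⊆ S := by
        rintro p (rfl | rfl | rfl) <;> assumption
      generalize ({r, k, c} : Set V) = P at hP
      clear hrS hkS hcS hdom hlt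
      induction hS with
      | refl => exact ⟨subset_rfl, .refl⟩
      | @tail S T _ hstep ih =>
        obtain ⟨x, y, hx, hdom, ⟨w, hw, hlt⟩, rfl⟩ := hstep
        obtain ⟨h₁, h₂⟩ := ih (hP.trans (Finset.coe_subset.2 (Finset.erase_subset ..)))
        refine ⟨(Finset.erase_subset ..).trans h₁, ?_⟩
        by_cases hy : y ∈ S
        · refine h₂.tail ⟨x, y, hx, hy, fun h => Finset.notMem_erase y S (hP h), ?_, hdom, rfl⟩
          rintro rfl
          exact lt_irrefl _ hlt
        · rwa [Finset.erase_eq_of_notMem hy]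
    exact ⟨r, H.1 hrS, c, H.1 hcS, hlt, S, H.2, hdom⟩
  · rintro ⟨r, hr, c, hc, hlt, S, hS, hdom⟩
    have hP : ({r, k, c} : Set V) ⊆ S := subset_of_reflTransGen (by
      rintro p (rfl | rfl | rfl) <;> assumption) hS
    obtain ⟨T, hT, hST, hcover⟩ := exists_strict_of_weak hS
    have hrS : r ∈ S := hP (by simp)
    have hkS : k ∈ S := hP (by simp)
    have hcS : c ∈ S := hP (by simp)
    exact ⟨T.erase k, hT.tail ⟨r, k, hST hrS, hdom.of_cover hST hcover hrS hkS,
      ⟨c, hST hcS, hlt⟩, rfl⟩, Finset.notMem_erase k T⟩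

end Game
end SymmetricElimination

/-! ### The algorithm -/

namespace StackProg

/-- A strategy as the algorithm sees it: the bit tells the rows from the columns. -/
abbrev Strategy : Type := Bool × ℕ

/-- The payoff in row `i` and column `j`. -/
def entryAt (A : List (List Entry)) (i j : ℕ) : Entry := (A.getD i []).getD j ([], [])

/-- Whether, of two strategies `x` and `y` of the same player, `x` is at least as good as `y`
against `w`. Two strategies of one player do not meet. The columns prefer small entries. -/
def atLeast (A : List (List Entry)) (x y w : Strategy) : Bool :=
  (w.1 == y.1) || bif y.1 then leEntry (entryAt A y.2 w.2) (entryAt A x.2 w.2)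
    else leEntry (entryAt A w.2 x.2) (entryAt A w.2 y.2)

/-- Whether `x` is at least as good as `y` against all strategies in the list `S`. -/
def dominates (A : List (List Entry)) (S : List Strategy) (x y : Strategy) : Bool :=
  (x.1 == y.1) && S.all fun w => atLeast A x y w

/-- Equality of strategies. -/
def sameStrategy (x y : Strategy) : Bool := (x.1 == y.1) && (x.2 == y.2)

/-- Whether `y` is not in the list `P` and another strategy in `S` is at least as good. -/
def removable (A : List (List Entry)) (P S : List Strategy) (y : Strategy) : Bool :=
  (!P.any fun p => sameStrategy p y) && S.any fun x => !sameStrategy x y && dominates A S x y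

/-- Removes `y` from `S` if this is a weak elimination that spares `P`. -/
def tryRemove (A : List (List Entry)) (P S : List Strategy) (y : Strategy) : List Strategy :=
  bif removable A P S y then S.filter fun x => !sameStrategy x y else S

/-- Tries to remove the strategies in the list `L`, one after the other. -/
def sweep (A : List (List Entry)) (P L S : List Strategy) : List Strategy :=
  L.foldl (fun S y => tryRemove A P S y) S

/-- Sweeps as often as there are strategies. -/
def reduce (A : List (List Entry)) (P L : List Strategy) : List Strategy :=
  L.foldl (fun S _ => sweep A P L S) L

/-- The strategies of a game with matrix `A`. -/
def strategies (A : List (List Entry)) : List Strategy :=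
  (List.range A.length).map (fun i => (true, i)) ++
    (List.range (A.headD []).length).map fun j => (false, j)

/-- The algorithm: the row `k` is eliminable if for some `r` that beats `k` against some `c`, weak
elimination that spares these three makes `r` at least as good as `k`. -/
def decideEliminable (k : Strategy) (A : List (List Entry)) : Bool :=
  (strategies A).any fun r => (strategies A).any fun c =>
    !atLeast A k r c && dominates A (reduce A [r, k, c] (strategies A)) r k

variable {α : Type} [Enc α]

namespace PolyTime

@[fun_prop]
theorem atLeast {A : α → List (List Entry)} {x y w : α → Strategy} (hA : PolyTime A)
    (hx : PolyTime x) (hy : PolyTime y) (hw : PolyTime w) :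
    PolyTime fun a => atLeast (A a) (x a) (y a) (w a) := by
  unfold StackProg.atLeast entryAt
  fun_prop

@[fun_prop]
theorem sameStrategy {x y : α → Strategy} (hx : PolyTime x) (hy : PolyTime y) :
    PolyTime fun a => sameStrategy (x a) (y a) := by
  unfold StackProg.sameStrategy
  fun_prop

@[fun_prop]
theorem dominates {A : α → List (List Entry)} {S : α → List Strategy} {x y : α → Strategy}
    (hA : PolyTime A) (hS : PolyTime S) (hx : PolyTime x) (hy : PolyTime y) :
    PolyTime fun a => dominates (A a) (S a) (x a) (y a) := by
  have h := all (f := fun a w => StackProg.atLeast (A a) (x a) (y a) w) hS (by fun_prop)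
  unfold StackProg.dominates
  fun_prop

@[fun_prop]
theorem removable {A : α → List (List Entry)} {P S : α → List Strategy} {y : α → Strategy}
    (hA : PolyTime A) (hP : PolyTime P) (hS : PolyTime S) (hy : PolyTime y) :
    PolyTime fun a => removable (A a) (P a) (S a) (y a) := by
  have h := any (f := fun a p => StackProg.sameStrategy p (y a)) hP (by fun_prop)
  have h' := any (f := fun a x => !StackProg.sameStrategy x (y a) &&
    StackProg.dominates (A a) (S a) x (y a)) hS (by fun_prop)
  unfold StackProg.removable
  fun_prop

@[fun_prop]
theorem tryRemove {A : α → List (List Entry)} {P S : α → List Strategy} {y : α → Strategy}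
    (hA : PolyTime A) (hP : PolyTime P) (hS : PolyTime S) (hy : PolyTime y) :
    PolyTime fun a => tryRemove (A a) (P a) (S a) (y a) := by
  have h := filter (f := fun a x => !StackProg.sameStrategy x (y a)) hS (by fun_prop)
  unfold StackProg.tryRemove
  fun_prop

end PolyTime

theorem size_filter_le {β : Type} [Enc β] (l : List β) (p : β → Bool) :
    size (l.filter p) ≤ size l := by
  induction l with
  | nil => exact le_rfl
  | cons b l ih =>
    rw [List.filter_cons, size_cons]
    split_ifs
    · rw [size_cons]; omega
    · omega

theorem size_tryRemove_le (A : List (List Entry)) (P S : List Strategy) (y : Strategy) :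
    size (tryRemove A P S y) ≤ size S := by
  unfold tryRemove
  cases removable A P S y
  · exact le_rfl
  · exact size_filter_le ..

theorem size_sweep_le (A : List (List Entry)) (P L S : List Strategy) :
    size (sweep A P L S) ≤ size S := by
  unfold sweep
  induction L generalizing S with
  | nil => exact le_rfl
  | cons y L ih => exact (ih _).trans (size_tryRemove_le A P S y)

namespace PolyTime

@[fun_prop]
theorem sweep {A : α → List (List Entry)} {P L S : α → List Strategy}
    (hA : PolyTime A) (hP : PolyTime P) (hL : PolyTime L) (hS : PolyTime S) :
    PolyTime fun a => sweep (A a) (P a) (L a) (S a) := by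
  have h := foldl_of_size_le (f := fun a S y => StackProg.tryRemove (A a) (P a) S y) hL hS
    (by fun_prop) 0 fun a s b => by simpa using size_tryRemove_le ..
  exact h

@[fun_prop]
theorem reduce {A : α → List (List Entry)} {P L : α → List Strategy}
    (hA : PolyTime A) (hP : PolyTime P) (hL : PolyTime L) :
    PolyTime fun a => reduce (A a) (P a) (L a) := by
  have h := foldl_of_size_le (f := fun a S _ => StackProg.sweep (A a) (P a) (L a) S) hL hL
    (by fun_prop) 0 fun a s b => by simpa using size_sweep_le ..
  exact h

@[fun_prop]
theorem strategies {A : α → List (List Entry)} (hA : PolyTime A) :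
    PolyTime fun a => strategies (A a) := by
  have h := map (f := fun _ i => (true, i)) hA.range_length (by fun_prop)
  have h' := map (f := fun _ j => (false, j)) (hA.headD (const [])).range_length (by fun_prop)
  exact h.append h'

theorem decideEliminable {k : α → Strategy} {A : α → List (List Entry)} (hk : PolyTime k)
    (hA : PolyTime A) : PolyTime fun a => decideEliminable (k a) (A a) := by
  refine any (f := fun a r => (StackProg.strategies (A a)).any fun c =>
    !StackProg.atLeast (A a) (k a) r c && StackProg.dominates (A a)
      (StackProg.reduce (A a) [r, k a, c] (StackProg.strategies (A a))) r (k a)) (by fun_prop) ?_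
  refine any (f := fun (p : α × Strategy) c => !StackProg.atLeast (A p.1) (k p.1) p.2 c &&
    StackProg.dominates (A p.1)
      (StackProg.reduce (A p.1) [p.2, k p.1, c] (StackProg.strategies (A p.1))) p.2 (k p.1))
    (by fun_prop) ?_
  fun_prop

end PolyTime

/-! ### Correctness of the algorithm -/

open SymmetricElimination Relation

variable {n m : ℕ}

/-- The constant-sum game with matrix `M`, with both players treated alike. -/
def gameOf (M : Matrix (Fin n) (Fin m) ℚ) : Game (Fin n ⊕ Fin m) where
  side := Sum.isLeft
  U
    | .inl i, .inr j => M i j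
    | .inr j, .inl i => -M i j
    | _, _ => 0
  antisymm := by rintro (i | i) (j | j) <;> simp
  zero := by rintro (i | i) (j | j) <;> simp

/-- A strategy of a game, as the algorithm sees it. -/
def toStrategy : Fin n ⊕ Fin m → Strategy
  | .inl i => (true, i)
  | .inr j => (false, j)

theorem sameStrategy_toStrategy (x y : Fin n ⊕ Fin m) :
    sameStrategy (toStrategy x) (toStrategy y) = true ↔ x = y := by
  rcases x with i | i <;> rcases y with j | j <;> simp [sameStrategy, toStrategy, Fin.ext_iff]

theorem entryAt_rowsOf (M : Matrix (Fin n) (Fin m) ℚ) (i : Fin n) (j : Fin m) :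
    entryAt (rowsOf M) i j = entryOf (M i j) := by
  simp [entryAt, rowsOf]

theorem atLeast_toStrategy (M : Matrix (Fin n) (Fin m) ℚ) {x y : Fin n ⊕ Fin m}
    (h : (gameOf M).side x = (gameOf M).side y) (w : Fin n ⊕ Fin m) :
    atLeast (rowsOf M) (toStrategy x) (toStrategy y) (toStrategy w) = true ↔
      (gameOf M).U y w ≤ (gameOf M).U x w := by
  rcases x with i | i <;> rcases y with j | j <;> rcases w with l | l <;>
    simp [gameOf] at h <;>
    simp [atLeast, toStrategy, gameOf, entryAt_rowsOf, leEntry_entryOf]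

/-- The list `L` consists of the strategies in `S`. -/
def Represents (L : List Strategy) (S : Finset (Fin n ⊕ Fin m)) : Prop :=
  ∀ s, s ∈ L ↔ ∃ v ∈ S, toStrategy v = s

theorem dominates_iff (M : Matrix (Fin n) (Fin m) ℚ) {L : List Strategy}
    {S : Finset (Fin n ⊕ Fin m)} (hL : Represents L S) (x y : Fin n ⊕ Fin m) :
    dominates (rowsOf M) L (toStrategy x) (toStrategy y) = true ↔ (gameOf M).Dom S x y := by
  have h₁ : (toStrategy x).1 = (toStrategy y).1 ↔ (gameOf M).side x = (gameOf M).side y := by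
    rcases x with i | i <;> rcases y with j | j <;> simp [toStrategy, gameOf]
  rw [dominates, Bool.and_eq_true, beq_iff_eq, h₁, List.all_eq_true]
  refine and_congr_right fun h => ⟨fun H w hw => ?_, fun H s hs => ?_⟩
  · exact (atLeast_toStrategy M h w).1 (H _ ((hL _).2 ⟨w, hw, rfl⟩))
  · obtain ⟨w, hw, rfl⟩ := (hL s).1 hs
    exact (atLeast_toStrategy M h w).2 (H w hw)

theorem removable_iff (M : Matrix (Fin n) (Fin m) ℚ) (P : List (Fin n ⊕ Fin m))
    {L : List Strategy} {S : Finset (Fin n ⊕ Fin m)} (hL : Represents L S) (y : Fin n ⊕ Fin m) :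
    removable (rowsOf M) (P.map toStrategy) L (toStrategy y) = true ↔
      y ∉ P ∧ ∃ x ∈ S, x ≠ y ∧ (gameOf M).Dom S x y := by
  rw [removable, Bool.and_eq_true, Bool.not_eq_true', ← Bool.not_eq_true, List.any_eq_true,
    List.any_eq_true]
  refine and_congr (not_congr ⟨?_, fun h => ?_⟩) ⟨?_, ?_⟩
  · rintro ⟨s, hs, hsy⟩
    obtain ⟨p, hp, rfl⟩ := List.mem_map.1 hs
    rwa [← (sameStrategy_toStrategy p y).1 hsy]
  · exact ⟨_, List.mem_map_of_mem h, (sameStrategy_toStrategy y y).2 rfl⟩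
  · rintro ⟨s, hs, h⟩
    obtain ⟨x, hx, rfl⟩ := (hL s).1 hs
    rw [Bool.and_eq_true, Bool.not_eq_true', ← Bool.not_eq_true, sameStrategy_toStrategy,
      dominates_iff M hL] at h
    exact ⟨x, hx, h⟩
  · rintro ⟨x, hx, h⟩
    refine ⟨_, (hL _).2 ⟨x, hx, rfl⟩, ?_⟩
    rw [Bool.and_eq_true, Bool.not_eq_true', ← Bool.not_eq_true, sameStrategy_toStrategy,
      dominates_iff M hL]
    exact h

theorem tryRemove_spec (M : Matrix (Fin n) (Fin m) ℚ) (P : List (Fin n ⊕ Fin m))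
    {L : List Strategy} {S : Finset (Fin n ⊕ Fin m)} (hL : Represents L S) (y : Fin n ⊕ Fin m) :
    ∃ S', Represents (tryRemove (rowsOf M) (P.map toStrategy) L (toStrategy y)) S' ∧
      ReflTransGen ((gameOf M).WeakStep {p | p ∈ P}) S S' ∧ S' ⊆ S ∧
      (S' = S → ¬ (y ∈ S ∧ y ∉ P ∧ ∃ x ∈ S, x ≠ y ∧ (gameOf M).Dom S x y)) := by
  have h := removable_iff M P hL y
  unfold tryRemove
  cases hr : removable (rowsOf M) (P.map toStrategy) L (toStrategy y) with
  | false =>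
    rw [hr] at h
    exact ⟨S, hL, .refl, subset_rfl, fun _ hcon => by simpa using h.2 hcon.2⟩
  | true =>
    obtain ⟨hyP, x, hx, hxy, hdom⟩ := h.1 hr
    refine ⟨S.erase y, fun s => ?_, ?_, Finset.erase_subset .., fun he hcon => ?_⟩
    · rw [cond_true, List.mem_filter, hL]
      constructor
      · rintro ⟨⟨v, hv, rfl⟩, hs⟩
        refine ⟨v, Finset.mem_erase.2 ⟨?_, hv⟩, rfl⟩
        rintro rfl
        rw [(sameStrategy_toStrategy v v).2 rfl] at hs
        simp at hs
      · rintro ⟨v, hv, rfl⟩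
        obtain ⟨hvy, hv⟩ := Finset.mem_erase.1 hv
        refine ⟨⟨v, hv, rfl⟩, ?_⟩
        rw [Bool.not_eq_true', ← Bool.not_eq_true, sameStrategy_toStrategy]
        exact hvy
    · by_cases hy : y ∈ S
      · exact .single ⟨x, y, hx, hy, hyP, hxy, hdom, rfl⟩
      · rw [Finset.erase_eq_of_notMem hy]
    · exact Finset.erase_eq_self.1 he hcon.1

theorem sweep_spec (M : Matrix (Fin n) (Fin m) ℚ) (P K : List (Fin n ⊕ Fin m)) :
    ∀ {L : List Strategy} {S : Finset (Fin n ⊕ Fin m)}, Represents L S →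
    ∃ S', Represents (sweep (rowsOf M) (P.map toStrategy) (K.map toStrategy) L) S' ∧
      ReflTransGen ((gameOf M).WeakStep {p | p ∈ P}) S S' ∧ S' ⊆ S ∧
      (S' = S → ∀ y ∈ K, ¬ (y ∈ S ∧ y ∉ P ∧ ∃ x ∈ S, x ≠ y ∧ (gameOf M).Dom S x y)) := by
  induction K with
  | nil => exact fun hL => ⟨_, hL, .refl, subset_rfl, by simp⟩
  | cons y K ih =>
    intro L S hL
    obtain ⟨S₁, h₁, h₂, h₃, h₄⟩ := tryRemove_spec M P hL y
    obtain ⟨S₂, h₅, h₆, h₇, h₈⟩ := ih h₁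
    refine ⟨S₂, h₅, h₂.trans h₆, h₇.trans h₃, ?_⟩
    rintro rfl z hz
    obtain rfl := h₇.antisymm h₃
    rcases List.mem_cons.1 hz with rfl | hz
    · exact h₄ rfl
    · exact h₈ rfl z hz

theorem reduce_spec (M : Matrix (Fin n) (Fin m) ℚ) (P K : List (Fin n ⊕ Fin m))
    (hK : ∀ v, v ∈ K) (hK' : K.length = Fintype.card (Fin n ⊕ Fin m)) :
    ∃ S, Represents (reduce (rowsOf M) (P.map toStrategy) (K.map toStrategy)) S ∧
      ReflTransGen ((gameOf M).WeakStep {p | p ∈ P}) Finset.univ S ∧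
      ∀ S', ¬ (gameOf M).WeakStep {p | p ∈ P} S S' := by
  -- each sweep removes a strategy unless no strategy can be removed any more
  have H : ∀ (W : List Strategy) (L : List Strategy) (S : Finset (Fin n ⊕ Fin m)),
      Represents L S → ∃ S', Represents (W.foldl (fun S _ =>
          sweep (rowsOf M) (P.map toStrategy) (K.map toStrategy) S) L) S' ∧
        ReflTransGen ((gameOf M).WeakStep {p | p ∈ P}) S S' ∧
        ((∀ T, ¬ (gameOf M).WeakStep {p | p ∈ P} S' T) ∨ S'.card + W.length ≤ S.card) := by
    intro W
    induction W with
    | nil => exact fun L S hL => ⟨S, hL, .refl, .inr le_rfl⟩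
    | cons s W ih =>
      intro L S hL
      obtain ⟨S₁, h₁, h₂, h₃, h₄⟩ := sweep_spec M P K hL
      obtain ⟨S₂, h₅, h₆, h₇⟩ := ih _ S₁ h₁
      refine ⟨S₂, h₅, h₂.trans h₆, ?_⟩
      rcases eq_or_ne S₁ S with rfl | hne
      · left
        have hterm : ∀ T, ¬ (gameOf M).WeakStep {p | p ∈ P} S₁ T := by
          rintro T ⟨x, y, hx, hy, hyP, hxy, hdom, -⟩
          exact h₄ rfl y (hK y) ⟨hy, hyP, x, hx, hxy, hdom⟩
        rcases h₆.cases_head with rfl | ⟨T, hT, -⟩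
        · exact hterm
        · exact absurd hT (hterm T)
      · refine h₇.imp_right fun h => ?_
        have := Finset.card_lt_card (h₃.ssubset_of_ne hne)
        rw [List.length_cons]
        omega
  have h₀ : Represents (K.map toStrategy) (Finset.univ : Finset (Fin n ⊕ Fin m)) := fun s => by
    simp [hK]
  obtain ⟨S, h₁, h₂, h₃⟩ := H (K.map toStrategy) _ _ h₀
  refine ⟨S, h₁, h₂, h₃.elim id fun h => ?_⟩
  rw [List.length_map, hK', Finset.card_univ] at h
  obtain rfl := Finset.card_eq_zero.1 (show S.card = 0 by omega)
  rintro T ⟨x, y, hx, -⟩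
  exact absurd hx (Finset.notMem_empty x)

theorem strategies_rowsOf (M : Matrix (Fin n) (Fin m) ℚ) (hn : 0 < n) :
    strategies (rowsOf M) =
      ((List.finRange n).map Sum.inl ++ (List.finRange m).map Sum.inr).map toStrategy := by
  have h : ((rowsOf M).headD []).length = m := by
    obtain ⟨n, rfl⟩ := Nat.exists_eq_succ_of_ne_zero hn.ne'
    simp [rowsOf, List.finRange_succ]
  have h' : (rowsOf M).length = n := by simp [rowsOf]
  rw [strategies, h, h', List.map_append, List.map_map, List.map_map]
  congr 1
  · rw [← List.map_coe_finRange_eq_range, List.map_map]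
    rfl
  · rw [← List.map_coe_finRange_eq_range, List.map_map]
    rfl

theorem decideEliminable_iff (M : Matrix (Fin n) (Fin m) ℚ) (k : Fin n) :
    decideEliminable (true, k) (rowsOf M) = true ↔
      ∃ T, ReflTransGen (gameOf M).StrictStep Finset.univ T ∧ Sum.inl k ∉ T := by
  set K : List (Fin n ⊕ Fin m) :=
    (List.finRange n).map Sum.inl ++ (List.finRange m).map Sum.inr with hKdef
  have hK : ∀ v, v ∈ K := by rintro (v | v) <;> simp [hKdef]
  have hK' : K.length = Fintype.card (Fin n ⊕ Fin m) := by simp [hKdef]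
  have key : ∀ r c : Fin n ⊕ Fin m,
      (!atLeast (rowsOf M) (true, k) (toStrategy r) (toStrategy c) &&
        dominates (rowsOf M) (reduce (rowsOf M) [toStrategy r, (true, (k : ℕ)), toStrategy c]
          (K.map toStrategy)) (toStrategy r) (true, k)) = true ↔
      (gameOf M).U (.inl k) c < (gameOf M).U r c ∧
        (gameOf M).Reachable {r, .inl k, c} r (.inl k) Finset.univ := by
    intro r c
    obtain ⟨S, h₁, h₂, h₃⟩ := reduce_spec M [r, .inl k, c] K hK hK'
    have hP : {p | p ∈ [r, .inl k, c]} = ({r, .inl k, c} : Set (Fin n ⊕ Fin m)) := by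
      ext p; simp
    rw [hP] at h₂ h₃
    have h₄ := dominates_iff M h₁ r (.inl k)
    rw [Game.reachable_iff_of_terminal (by simp) (by simp) (by simp) h₂ h₃, ← h₄,
      Bool.and_eq_true]
    refine and_congr_left fun h => ?_
    rw [← not_le, ← atLeast_toStrategy M (h₄.1 h).1.symm c, Bool.not_eq_true', Bool.not_eq_true]
    rfl
  rw [Game.exists_strict_iff (Finset.mem_univ _), decideEliminable,
    strategies_rowsOf M (Fin.pos k), ← hKdef]
  simp only [List.any_eq_true, List.mem_map, hK, true_and, Finset.mem_univ]
  constructor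
  · rintro ⟨_, ⟨r, rfl⟩, _, ⟨c, rfl⟩, h⟩
    exact ⟨r, c, (key r c).1 h⟩
  · rintro ⟨r, c, h⟩
    exact ⟨_, ⟨r, rfl⟩, _, ⟨c, rfl⟩, (key r c).2 h⟩

/-- Elimination in a constant-sum game, with both players treated alike. -/
theorem eliminable_iff (G : BimatrixGame n m) (hG : G.IsConstantSum) (k : Fin n) :
    G.Eliminable k ↔
      ∃ T, ReflTransGen (gameOf G.A).StrictStep Finset.univ T ∧ Sum.inl k ∉ T := by
  obtain ⟨c, hc⟩ := hG
  have hB : ∀ i j, G.B i j = c - G.A i j := fun i j => by linarith [hc i j]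
  constructor
  · rintro ⟨I, J, h, hk⟩
    have h₁ := h.lift (p := (gameOf G.A).StrictStep)
      (fun S : BimatrixGame.Subgame n m => S.1.disjSum S.2) (by
        rintro _ _ (⟨I, J, i, i₀, hi₀, weak, j₀, hj₀, strict⟩ |
          ⟨I, J, j, j₀, hj₀, weak, i₀, hi₀, strict⟩)
        · refine ⟨.inl i₀, .inl i, by simpa using hi₀, ⟨rfl, ?_⟩,
            ⟨.inr j₀, by simpa using hj₀, strict⟩, ?_⟩
          · rintro (w | w) hw
            · exact le_rfl
            · exact weak w (by simpa using hw)
          · ext (w | w) <;> simp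
        · refine ⟨.inr j₀, .inr j, by simpa using hj₀, ⟨rfl, ?_⟩,
            ⟨.inl i₀, by simpa using hi₀, ?_⟩, ?_⟩
          · rintro (w | w) hw
            · have := weak w (by simpa using hw)
              rw [hB, hB] at this
              show -G.A w j ≤ -G.A w j₀
              linarith
            · exact le_rfl
          · rw [hB, hB] at strict
            show -G.A i₀ j < -G.A i₀ j₀
            linarith
          · ext (w | w) <;> simp)
    refine ⟨I.disjSum J, ?_, by simpa using hk⟩
    have h₂ : (Finset.univ : Finset (Fin n)).disjSum (Finset.univ : Finset (Fin m)) =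
        Finset.univ := by ext (w | w) <;> simp
    rw [← h₂]
    exact h₁
  · rintro ⟨T, h, hk⟩
    have h₁ := h.lift (p := G.DominanceStep)
      (fun S : Finset (Fin n ⊕ Fin m) => (S.toLeft, S.toRight)) (by
        rintro S _ ⟨x, y, hx, ⟨hside, hdom⟩, ⟨w, hw, hlt⟩, rfl⟩
        rcases x with x | x <;> rcases y with y | y
        · rcases w with w | w
          · exact absurd hlt (lt_irrefl _)
          have h₂ : ((S.erase (.inl y)).toLeft, (S.erase (.inl y)).toRight) =
              (S.toLeft.erase y, S.toRight) := by
            ext z <;> simp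
          change G.DominanceStep (S.toLeft, S.toRight)
            ((S.erase (.inl y)).toLeft, (S.erase (.inl y)).toRight)
          rw [h₂]
          exact .row _ _ y x (by simpa using hx) (fun j hj => hdom (.inr j) (by simpa using hj))
            ⟨w, by simpa using hw, hlt⟩
        · simp [gameOf] at hside
        · simp [gameOf] at hside
        · rcases w with w | w
          swap
          · exact absurd hlt (lt_irrefl _)
          have h₂ : ((S.erase (.inr y)).toLeft, (S.erase (.inr y)).toRight) =
              (S.toLeft, S.toRight.erase y) := by
            ext z <;> simp
          change G.DominanceStep (S.toLeft, S.toRight)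
            ((S.erase (.inr y)).toLeft, (S.erase (.inr y)).toRight)
          rw [h₂]
          refine .col _ _ y x (by simpa using hx) (fun i hi => ?_) ⟨w, by simpa using hw, ?_⟩
          · have : -G.A i y ≤ -G.A i x := hdom (.inl i) (by simpa using hi)
            rw [hB, hB]
            linarith
          · have : -G.A w y < -G.A w x := hlt
            rw [hB, hB]
            linarith)
    refine ⟨T.toLeft, T.toRight, ?_, by simpa using hk⟩
    have h₂ : ((Finset.univ : Finset (Fin n ⊕ Fin m)).toLeft,
        (Finset.univ : Finset (Fin n ⊕ Fin m)).toRight) = (Finset.univ, Finset.univ) := by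
      ext z <;> simp
    rw [← h₂]
    exact h₁

end StackProg

theorem theorem6p4 : DecidableInPolyTime encodeZDominanceInstance ZDominance := by
  have h : StackProg.PolyTime fun w : List GameSymbol =>
      StackProg.decideEliminable (true, (StackProg.parse w).1) (StackProg.parse w).2 :=
    .decideEliminable (.prodMk (.const true) StackProg.PolyTime.parse.fst)
      StackProg.PolyTime.parse.snd
  refine StackProg.decidableInPolyTime_of_polyTime _ _ h fun x => ?_
  rw [StackProg.parse_encode, StackProg.decideEliminable_iff, ZDominance,
    StackProg.eliminable_iff _ x.constantSum]
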